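/- Let $\mathbb{D}$ be the open unit disk, $\mathbb{T}$ the unit circle and $m$ the normalized Lebesgue measure on $\mathbb{T}$. Let $(\alpha_k)_{k\ge 0}\subset\mathbb{D}$ with $\alpha_0=0$ and $$\sum_k (1-|\alpha_k|)=+\infty .$$ Let $f$ be a Schur function, i.e. $f$ is holomorphic in $\mathbb{D}$ and $|f|\le 1$ there, and let $\mu$ be the Borel probability measure on $\mathbb{T}$ given by $$\frac{1+zf(z)}{1-zf(z)}=\int_{\mathbb{T}}\frac{t+z}{t-z}\,d\mu(t),\qquad z\in\mathbb{D}.$$ Write $d\mu=\mu'\,dm+d\mu_s$ for its Lebesgue decomposition with respect to $m$. Set $\zeta_k(z)=\frac{z-\alpha_k}{1-\bar\alpha_k z}$ and define the Schur remainders $f_k$ of $f$ by $$f_0=f,\qquad \gamma_k=f_k(\alpha_{k+1}),\qquad f_{k+1}=\frac{1}{\zeta_{k+1}}\,\frac{f_k-\gamma_k}{1-\bar\gamma_k f_k}$$ (with the removable singularity at $\alpha_{k+1}$ filled in). The same letters denote the nontangential boundary values on $\mathbb{T}$, which exist $m$-a.e. Let $P(t,w)=(1-|w|^2)/|t-w|^2$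 be the Poisson kernel, and let $Acc(\alpha_k)=\overline{\{\alpha_k\}}\setminus\{\alpha_k\}$. Assume that $|f|<1$ $m$-a.e. on $\mathbb{T}$, that $Acc(\alpha_k)\cap\mathbb{T}$ does not meet the closed support of $\mu_s$, and that at least one of the following holds: 1. $\mu'$ is continuous and positive on an open neighborhood in $\mathbb{T}$ of $Acc(\alpha_k)\cap\mathbb{T}$; 2. $(\alpha_k)$ accumulates nontangentially on $Acc(\alpha_k)\cap\mathbb{T}$ (every subsequence converging to some $\xi\in\mathbb{T}$ tends to $\xi$ nontangentially), and each $\xi\in Acc(\alpha_k)\cap\mathbb{T}$ is a Lebesgue point of $\mu'$ and of $\sqrt{\mu'}$ with $\mu'(\xi)>0$. (Here $\mu'$ is understood up to $m$-a.e. equality: the condition is required of some representative.) Then each $|f_k|^2P(\cdot,\alpha_k)$ is $m$-integrable and $$\lim_{k\to\infty}\int_{\mathbb{T}}|f_k|^2\,P(\cdot,\alpha_k)\,dm=0 .$$ -/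

import Mathlib

open Set Filter Topology MeasureTheory

noncomputable section

namespace MultipointSchur

instance : MeasurableSpace Circle := borel Circle

instance : BorelSpace Circle := ⟨rfl⟩

/-- Normalized Lebesgue measure `dm = dθ / 2π` (with `t = exp (iθ)`) on the unit circle. -/
def m : Measure Circle :=
  ENNReal.ofReal (2 * Real.pi)⁻¹ •
    (volume.restrict (Ioc (-Real.pi) Real.pi)).map (fun θ : ℝ => Circle.exp θ)

/-- The Schur class: holomorphic functions on the open unit disk bounded by one.
Only the values of `f` in the open unit disk are relevant. -/
def IsSchur (f : ℂ → ℂ) : Prop :=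
  DifferentiableOn ℂ f (Metric.ball 0 1) ∧ ∀ z ∈ Metric.ball (0 : ℂ) 1, ‖f z‖ ≤ 1

/-- Nontangential approach region (Stolz type region) with vertex `ξ` and aperture `C`. -/
def stolz (C : ℝ) (ξ : Circle) : Set ℂ :=
  {z | ‖z‖ < 1 ∧ ‖z - ξ‖ ≤ C * (1 - ‖z‖)}

/-- Nontangential approach to `ξ`: a function tends to `L` along this filter iff it tends to `L`
at `ξ` within every nontangential approach region with vertex `ξ`. -/
def nontangential (ξ : Circle) : Filter ℂ :=
  ⨆ C : ℝ, 𝓝[stolz C ξ] (ξ : ℂ)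

/-- The trace on the unit circle (nontangential limit) of a function on the disk. -/
def trace (g : ℂ → ℂ) (ξ : Circle) : ℂ :=
  limUnder (nontangential ξ) g

/-- One step of the multipoint Schur algorithm at the node `a`:
with `γ = g a` and `ζ z = (z - a) / (1 - conj a * z)`, this is
`(1 / ζ) * (g - γ) / (1 - conj γ * g)`, where the removable singularity at `a` is filled in.
Since `h = (g - γ) / (1 - conj γ * g)` vanishes at `a`, `dslope h a z` is `h z / (z - a)` for
`z ≠ a`, and it is `deriv h a` for `z = a`. -/
def schurStep (a : ℂ) (g : ℂ → ℂ) : ℂ → ℂ := fun z =>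
  (1 - (starRingEnd ℂ) a * z) *
    dslope (fun w => (g w - g a) / (1 - (starRingEnd ℂ) (g a) * g w)) a z

/-- The Schur remainders `f_k` of `f` for the nodes `α 1, α 2, …`. -/
def schurRemainder (α : ℕ → ℂ) (f : ℂ → ℂ) : ℕ → ℂ → ℂ
  | 0 => f
  | k + 1 => schurStep (α (k + 1)) (schurRemainder α f k)

/-- `μ` is the Herglotz measure of `f`:
`(1 + z f(z)) / (1 - z f(z)) = ∫ (t + z) / (t - z) dμ(t)` in the open unit disk. -/
def IsHerglotzMeasure (f : ℂ → ℂ) (μ : Measure Circle) : Prop :=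
  ∀ z ∈ Metric.ball (0 : ℂ) 1,
    (1 + z * f z) / (1 - z * f z) = ∫ t : Circle, ((t : ℂ) + z) / ((t : ℂ) - z) ∂μ

/-- The density `μ' = dμ_ac / dm` (a function defined up to `m`-a.e. equality). -/
def density (μ : Measure Circle) (t : Circle) : ℝ :=
  (μ.rnDeriv m t).toReal

/-- `Acc (α_k) ∩ 𝕋`, with `Acc (α_k) = closure (α_k) \ (α_k)`. -/
def accCircle (α : ℕ → ℂ) : Set Circle :=
  {ξ | (ξ : ℂ) ∈ closure (range α) \ range α}

/-- `μ'` is continuous and positive on an open neighborhood of `E`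
(for some representative of `μ'`). -/
def DensityContinuousPosNear (μ : Measure Circle) (E : Set Circle) : Prop :=
  ∃ U : Set Circle, IsOpen U ∧ E ⊆ U ∧
    ∃ h : Circle → ℝ, h =ᵐ[m] density μ ∧ ContinuousOn h U ∧ ∀ ξ ∈ U, 0 < h ξ

/-- `ξ` is a Lebesgue point of `h` (metric balls of the circle are arcs centered at `ξ`). -/
def IsLebesguePoint (h : Circle → ℝ) (ξ : Circle) : Prop :=
  Tendsto (fun r : ℝ => ⨍ t in Metric.ball ξ r, |h t - h ξ| ∂m) (𝓝[>] 0) (𝓝 0)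

/-- Every point of `E` is a Lebesgue point of `μ'` and of `√μ'`, and `μ' > 0` there
(for some representative of `μ'`). -/
def DensityLebesguePosOn (μ : Measure Circle) (E : Set Circle) : Prop :=
  ∃ h : Circle → ℝ, h =ᵐ[m] density μ ∧
    ∀ ξ ∈ E, IsLebesguePoint h ξ ∧ IsLebesguePoint (fun t => √(h t)) ξ ∧ 0 < h ξ

/-- Every subsequence of `α` that converges to a point of the unit circle does so
nontangentially. -/
def AccumulatesNontangentially (α : ℕ → ℂ) : Prop :=
  ∀ ξ : Circle, ∀ φ : ℕ → ℕ, StrictMono φ → Tendsto (fun k => α (φ k)) atTop (𝓝 (ξ : ℂ)) →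
    ∃ C : ℝ, ∀ᶠ k in atTop, α (φ k) ∈ stolz C ξ

end MultipointSchur

end

noncomputable section

namespace MultipointSchur

/-! ### Normalized Lebesgue measure on the circle -/

/-! Let `A_n` be the rational Schur function built from the first `n` Schur parameters followed by
the remainder `0`, and let `x_n` be the real part of `(1 + t A_n) / (1 - t A_n)` on the circle.
There, a backward Schur step applied to the remainder can be traded for a Blaschke step applied to
the unimodular factor in front of it (`cayleyRe_mul_moebius`). Iterating gives the factorization `μ'
= x_n q_n` a.e., where `q_n = cayleyRe (b_n f_n)` and `b_n` is a finite Blaschke product with `b_n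
(α_n) = 0` for `n ≥ 1` (`ae_density_eq_interpolantDensity_mul`).

Write `P` for the Poisson kernel at `α_n`. Since `b_n f_n` vanishes at `α_n`, the integral of `P Re
(b_n f_n)` is `0`, and by Fatou's lemma that of `P q_n` is at most `1`. If moreover the integral of
`P √q_n` is close to `1`, then `√q_n` is close to `1` in `L²(P dm)`, and the pointwise bound
`norm_sq_le_re_add` makes the integral of `P |b_n f_n|² = P |f_n|²` small (`integral_norm_sq_le`).
It remains to prove that the lower limit of the integrals of `P √q_n` is at least `1`.

For this, AM-GM applied to `√q_n, √q_n, s³ x_n` gives `3 s μ'^(1/3) ≤ 2 √q_n + s³ x_n` for every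
continuous `s ≥ 0` (`le_integral_sqrt`). The right side is linear in `x_n`, so only averages of
`x_n` have to be controlled. Along a subsequence `α_n` tends to some `a`.

If `|a| < 1`, the divergence of the Blaschke sum gives `A_n → f` in the disk, hence `x_n dm → μ`
weakly. Taking `s` close to `μ'^(-1/3)` off a null set carrying `μ_s`, and close to `0` on that set,
yields a lower bound close to `3 - 1 = 2` for twice the integral (`eventually_le_of_tendsto_disk`).

If `|a| = 1`, then `A_n (α_n) = f (α_n)` makes the integrals of `P x_n dm` and `P dμ` equal. The
regularity of `μ'` at `a` and the absence of `μ_s` nearby make them converge to `μ'(a)`, and the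
constant `s = μ'(a)^(-1/3)` gives `3 - 1 = 2` again (`eventually_le_of_tendsto_circle`). -/

lemma m_apply {S : Set Circle} (hS : MeasurableSet S) :
    m S = ENNReal.ofReal (2 * Real.pi)⁻¹ *
      volume ((fun θ : ℝ => Circle.exp θ) ⁻¹' S ∩ Ioc (-Real.pi) Real.pi) := by
  have hc : Measurable (fun θ : ℝ => Circle.exp θ) := Circle.exp.continuous.measurable
  rw [m, Measure.smul_apply, Measure.map_apply hc hS, Measure.restrict_apply (hc hS), smul_eq_mul]

instance : IsProbabilityMeasure m := by
  constructor
  rw [m_apply MeasurableSet.univ, preimage_univ, univ_inter, Real.volume_Ioc,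
    ← ENNReal.ofReal_mul (by positivity)]
  have : (2 * Real.pi)⁻¹ * (Real.pi - -Real.pi) = 1 := by
    have := Real.pi_pos
    field_simp
    ring
  rw [this, ENNReal.ofReal_one]

lemma integral_m_eq_circleAverage {E : Type*} [NormedAddCommGroup E] [NormedSpace ℝ E]
    (F : ℂ → E) (hF : Continuous fun t : Circle => F t) :
    ∫ t : Circle, F t ∂m = Real.circleAverage F 0 1 := by
  have hc : Measurable (fun θ : ℝ => Circle.exp θ) := Circle.exp.continuous.measurable
  rw [m, integral_smul_measure, integral_map hc.aemeasurable hF.aestronglyMeasurable,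
    Real.circleAverage, ENNReal.toReal_ofReal (by positivity),
    ← intervalIntegral.integral_of_le (by linarith [Real.pi_pos])]
  congr 1
  have hp : Function.Periodic (fun θ : ℝ => F (Circle.exp θ)) (2 * Real.pi) := by
    intro θ
    simp
  have := hp.intervalIntegral_add_eq (-Real.pi) 0
  rw [show -Real.pi + 2 * Real.pi = Real.pi by ring, zero_add] at this
  rw [this]
  refine intervalIntegral.integral_congr fun θ _ => ?_
  simp [circleMap, Circle.coe_exp]

lemma circle_dist_eq (s t : Circle) : dist s t = ‖(s : ℂ) - t‖ := by
  rw [← dist_eq_norm]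
  rfl

lemma dist_exp_exp (θ φ : ℝ) :
    dist (Circle.exp θ) (Circle.exp φ) = |2 * Real.sin ((θ - φ) / 2)| := by
  rw [circle_dist_eq, Circle.coe_exp, Circle.coe_exp]
  have h : Complex.exp (θ * Complex.I) - Complex.exp (φ * Complex.I)
      = Complex.exp (φ * Complex.I) * (Complex.exp (Complex.I * ((θ - φ : ℝ) : ℂ)) - 1) := by
    rw [mul_sub, ← Complex.exp_add]
    push_cast
    ring_nf
  rw [h, norm_mul, Complex.norm_exp_ofReal_mul_I, one_mul,
    Complex.norm_exp_I_mul_ofReal_sub_one, Real.norm_eq_abs]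

/-- Jordan's inequality `sin y ≥ 2 y / π` on `[0, π/2]`: arc length is at most `π/2` times the
chord. -/
lemma abs_le_of_two_mul_abs_sin_le {x r : ℝ} (hx : |x| ≤ Real.pi)
    (h : |2 * Real.sin (x / 2)| ≤ r) : |x| ≤ Real.pi / 2 * r := by
  have hpi := Real.pi_pos
  wlog hx0 : 0 ≤ x generalizing x
  · have := this (x := -x) (by rwa [abs_neg]) (by
      rwa [neg_div, Real.sin_neg, mul_neg, abs_neg]) (by linarith)
    rwa [abs_neg] at this
  rw [abs_of_nonneg hx0] at hx ⊢
  have h1 := Real.mul_le_sin (x := x / 2) (by linarith) (by linarith)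
  have h2 : 2 * Real.sin (x / 2) ≤ r := (le_abs_self _).trans h
  have h3 : 2 / Real.pi * x ≤ r := by linarith
  calc x = Real.pi / 2 * (2 / Real.pi * x) := by field_simp
    _ ≤ _ := by gcongr

lemma abs_sin_half_add_two_pi (x : ℝ) :
    |2 * Real.sin ((x + 2 * Real.pi) / 2)| = |2 * Real.sin (x / 2)| := by
  rw [show (x + 2 * Real.pi) / 2 = x / 2 + Real.pi by ring, Real.sin_add_pi, mul_neg, abs_neg]

lemma exists_exp_eq (ξ : Circle) : ∃ φ : ℝ, -Real.pi < φ ∧ φ ≤ Real.pi ∧ Circle.exp φ = ξ :=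
  ⟨_, Complex.neg_pi_lt_arg _, Complex.arg_le_pi _, Circle.exp_arg ξ⟩

lemma m_closedBall_le (ξ : Circle) {r : ℝ} (hr : 0 ≤ r) :
    m (Metric.closedBall ξ r) ≤ ENNReal.ofReal (3 / 2 * r) := by
  have hpi := Real.pi_pos
  obtain ⟨φ, h1, h2, rfl⟩ := exists_exp_eq ξ
  rw [m_apply Metric.isClosed_closedBall.measurableSet]
  set c := Real.pi / 2 * r with hcdef
  have hc : 0 ≤ c := by positivity
  -- The chord bound puts `θ` within `c` of `φ` modulo `2π`, and the fundamental domain may cut that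
  -- arc. Three translates cover it, of total length `6c = 3πr`; dividing by `2π` gives the constant
  -- `3/2`.
  have hsub : (fun θ : ℝ => Circle.exp θ) ⁻¹' Metric.closedBall (Circle.exp φ) r ∩
      Ioc (-Real.pi) Real.pi ⊆
      Icc (φ - c) (φ + c) ∪ (Icc (φ - 2 * Real.pi - c) (φ - 2 * Real.pi + c) ∪
        Icc (φ + 2 * Real.pi - c) (φ + 2 * Real.pi + c)) := by
    rintro θ ⟨h, h3, h4⟩
    rw [mem_preimage, Metric.mem_closedBall, dist_exp_exp] at h
    rcases le_total |θ - φ| Real.pi with h5 | h5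
    · left
      have := abs_le.1 (abs_le_of_two_mul_abs_sin_le h5 h)
      rw [← hcdef] at this
      constructor <;> linarith
    · right
      rcases le_total φ θ with h6 | h6
      · right
        rw [abs_of_nonneg (by linarith)] at h5
        have h7 : |2 * Real.sin ((θ - φ - 2 * Real.pi) / 2)| ≤ r := by
          rw [← abs_sin_half_add_two_pi]
          simpa using h
        have := abs_le.1 (abs_le_of_two_mul_abs_sin_le
          (abs_le.2 ⟨by linarith, by linarith⟩) h7)
        rw [← hcdef] at this
        constructor <;> linarith
      · left
        rw [abs_of_nonpos (by linarith)] at h5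
        have h7 : |2 * Real.sin ((θ - φ + 2 * Real.pi) / 2)| ≤ r := by
          rwa [abs_sin_half_add_two_pi]
        have := abs_le.1 (abs_le_of_two_mul_abs_sin_le
          (abs_le.2 ⟨by linarith, by linarith⟩) h7)
        rw [← hcdef] at this
        constructor <;> linarith
  have hvol : volume ((fun θ : ℝ => Circle.exp θ) ⁻¹' Metric.closedBall (Circle.exp φ) r ∩
      Ioc (-Real.pi) Real.pi) ≤ ENNReal.ofReal (6 * c) := by
    refine (measure_mono hsub).trans ((measure_union_le _ _).trans
      ((add_le_add_right (measure_union_le _ _) _).trans ?_))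
    rw [Real.volume_Icc, Real.volume_Icc, Real.volume_Icc, ← ENNReal.ofReal_add (by linarith)
      (by linarith), ← ENNReal.ofReal_add (by linarith) (by linarith)]
    apply ENNReal.ofReal_le_ofReal
    linarith
  refine (mul_le_mul_right hvol _).trans ?_
  rw [← ENNReal.ofReal_mul (by positivity)]
  apply ENNReal.ofReal_le_ofReal
  have : (2 * Real.pi)⁻¹ * (6 * c) = 3 / 2 * r := by
    rw [hcdef]
    field_simp
    ring
  rw [this]

lemma le_m_closedBall (ξ : Circle) {r : ℝ} (hr : 0 ≤ r) (hr' : r ≤ Real.pi) :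
    ENNReal.ofReal ((2 * Real.pi)⁻¹ * r) ≤ m (Metric.closedBall ξ r) := by
  have hpi := Real.pi_pos
  obtain ⟨φ, h1, h2, rfl⟩ := exists_exp_eq ξ
  rw [m_apply Metric.isClosed_closedBall.measurableSet, ENNReal.ofReal_mul (by positivity)]
  refine mul_le_mul_right ?_ _
  have key : ∀ θ, |θ - φ| ≤ r → Circle.exp θ ∈ Metric.closedBall (Circle.exp φ) r := by
    intro θ h
    rw [Metric.mem_closedBall, dist_exp_exp, abs_mul, abs_two]
    have := Real.abs_sin_le_abs (x := (θ - φ) / 2)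
    rw [abs_div, abs_two] at this
    linarith
  -- Half of the arc is enough; the half pointing towards `0` stays inside `(-π, π]`.
  rcases le_total 0 φ with h0 | h0
  · calc ENNReal.ofReal r = volume (Ioc (φ - r) φ) := by rw [Real.volume_Ioc]; ring_nf
      _ ≤ _ := measure_mono fun θ hθ => by
        exact ⟨key θ (abs_le.2 ⟨by linarith [hθ.1], by linarith [hθ.2]⟩),
          by linarith [hθ.1], by linarith [hθ.2]⟩
  · calc ENNReal.ofReal r = volume (Icc φ (φ + r)) := by rw [Real.volume_Icc]; ring_nf
      _ ≤ _ := measure_mono fun θ hθ => by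
        exact ⟨key θ (abs_le.2 ⟨by linarith [hθ.1], by linarith [hθ.2]⟩),
          by linarith [hθ.1], by linarith [hθ.2]⟩

/-- Doubling provides the Vitali family on which all almost-everywhere differentiation below rests.
-/
instance : IsUnifLocDoublingMeasure m := by
  refine ⟨⟨⟨6 * Real.pi, by positivity⟩, ?_⟩⟩
  filter_upwards [Ioo_mem_nhdsGT Real.pi_pos] with r hr x
  calc m (Metric.closedBall x (2 * r)) ≤ ENNReal.ofReal (3 / 2 * (2 * r)) :=
        m_closedBall_le x (by linarith [hr.1])
    _ = ENNReal.ofReal (6 * Real.pi) * ENNReal.ofReal ((2 * Real.pi)⁻¹ * r) := by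
        rw [← ENNReal.ofReal_mul (by positivity)]
        congr 1
        have := Real.pi_pos
        field_simp
        ring
    _ ≤ _ := by
        rw [ENNReal.ofReal, Real.toNNReal_of_nonneg (by positivity)]
        refine mul_le_mul_right ?_ _
        exact le_m_closedBall x hr.1.le hr.2.le

/-! ### The Poisson kernel of the unit disk -/

lemma poissonKernel_circle (t : Circle) (z : ℂ) :
    poissonKernel 0 z t = (1 - ‖z‖ ^ 2) / ‖(t : ℂ) - z‖ ^ 2 := by
  simp [poissonKernel_def, Circle.norm_coe]

lemma one_sub_norm_le (t : Circle) (z : ℂ) : 1 - ‖z‖ ≤ ‖(t : ℂ) - z‖ := by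
  have := norm_sub_norm_le (t : ℂ) z
  rwa [Circle.norm_coe] at this

lemma circle_sub_ne_zero (t : Circle) {z : ℂ} (hz : ‖z‖ < 1) : (t : ℂ) - z ≠ 0 := by
  rw [← norm_pos_iff]
  linarith [one_sub_norm_le t z]

lemma poissonKernel_nonneg (t : Circle) {z : ℂ} (hz : ‖z‖ < 1) : 0 ≤ poissonKernel 0 z t := by
  rw [poissonKernel_circle]
  have : ‖z‖ ^ 2 ≤ 1 := pow_le_one₀ (norm_nonneg _) hz.le
  exact div_nonneg (by linarith) (by positivity)

lemma poissonKernel_le_div (t : Circle) {z : ℂ} (hz : ‖z‖ < 1) :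
    poissonKernel 0 z t ≤ 2 * (1 - ‖z‖) / ‖(t : ℂ) - z‖ ^ 2 := by
  rw [poissonKernel_circle]
  gcongr
  nlinarith [norm_nonneg z]

lemma poissonKernel_le (t : Circle) {z : ℂ} (hz : ‖z‖ < 1) :
    poissonKernel 0 z t ≤ 2 / (1 - ‖z‖) := by
  have h : 0 < 1 - ‖z‖ := by linarith
  calc _ ≤ 2 * (1 - ‖z‖) / ‖(t : ℂ) - z‖ ^ 2 := poissonKernel_le_div t hz
    _ ≤ 2 * (1 - ‖z‖) / (1 - ‖z‖) ^ 2 := by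
        gcongr
        exact one_sub_norm_le t z
    _ = _ := by field_simp

lemma continuous_poissonKernel {z : ℂ} (hz : ‖z‖ < 1) :
    Continuous fun t : Circle => poissonKernel 0 z t := by
  simp_rw [poissonKernel_circle]
  refine continuous_const.div (by fun_prop) fun t => ?_
  exact pow_ne_zero 2 (norm_ne_zero_iff.2 (circle_sub_ne_zero t hz))

lemma poissonKernel_re_eq (t : Circle) (z : ℂ) :
    (((t : ℂ) + z) / ((t : ℂ) - z)).re = poissonKernel 0 z t := by
  rw [poissonKernel_eq_re_herglotzRieszKernel, Function.comp_apply, herglotzRieszKernel_def]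
  simp

lemma integrable_of_continuous {E : Type*} [NormedAddCommGroup E] {F : Circle → E}
    (hF : Continuous F) (ν : Measure Circle) [IsFiniteMeasure ν] : Integrable F ν :=
  hF.integrable_of_hasCompactSupport (HasCompactSupport.of_compactSpace F)

lemma integral_poissonKernel_smul {E : Type*} [NormedAddCommGroup E] [NormedSpace ℂ E]
    [CompleteSpace E] {F : ℂ → E} (hF : DiffContOnCl ℂ F (Metric.ball 0 1)) {z : ℂ}
    (hz : ‖z‖ < 1) : ∫ t : Circle, poissonKernel 0 z t • F t ∂m = F z := by
  rw [← hF.circleAverage_poissonKernel_smul (w := z) (by simpa using hz)]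
  refine integral_m_eq_circleAverage (poissonKernel 0 z • F) ?_
  refine (continuous_poissonKernel hz).smul ?_
  have := hF.2
  rw [closure_ball _ one_ne_zero] at this
  exact this.comp_continuous (by fun_prop) (by simp [Circle.norm_coe])

lemma integral_poissonKernel {z : ℂ} (hz : ‖z‖ < 1) :
    ∫ t : Circle, poissonKernel 0 z t ∂m = 1 := by
  have h := integral_poissonKernel_smul (F := fun _ => (1 : ℂ)) diffContOnCl_const hz
  simp only [Complex.real_smul, mul_one] at h
  rw [integral_complex_ofReal] at h
  exact_mod_cast h

/-! ### Boundary behaviour of Poisson integrals -/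

lemma stolz_subset_ball (C : ℝ) (ξ : Circle) : stolz C ξ ⊆ Metric.ball 0 1 := fun z hz => by
  simpa using hz.1

lemma nhdsWithin_stolz_le (C : ℝ) (ξ : Circle) :
    𝓝[stolz C ξ] (ξ : ℂ) ≤ 𝓝[Metric.ball 0 1] (ξ : ℂ) :=
  nhdsWithin_mono _ (stolz_subset_ball C ξ)

lemma eventually_norm_lt_one {l : Filter ℂ} {ξ : Circle}
    (hl : l ≤ 𝓝[Metric.ball 0 1] (ξ : ℂ)) : ∀ᶠ z in l, ‖z‖ < 1 :=
  hl (by filter_upwards [self_mem_nhdsWithin] with z hz using by simpa using hz)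

lemma integrable_poissonKernel_smul {E : Type*} [NormedAddCommGroup E] [NormedSpace ℝ E]
    {ν : Measure Circle} {g : Circle → E} (hg : Integrable g ν) {z : ℂ} (hz : ‖z‖ < 1) :
    Integrable (fun t : Circle => poissonKernel 0 z t • g t) ν := by
  refine hg.bdd_smul (2 / (1 - ‖z‖))
    (continuous_poissonKernel hz).aestronglyMeasurable (.of_forall fun t => ?_)
  rw [Real.norm_of_nonneg (poissonKernel_nonneg t hz)]
  exact poissonKernel_le t hz

lemma integrable_poissonKernel_mul {ν : Measure Circle} {g : Circle → ℝ} (hg : Integrable g ν)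
    {z : ℂ} (hz : ‖z‖ < 1) : Integrable (fun t : Circle => poissonKernel 0 z t * g t) ν :=
  integrable_poissonKernel_smul hg hz

lemma integrable_poissonKernel {ν : Measure Circle} [IsFiniteMeasure ν] {z : ℂ} (hz : ‖z‖ < 1) :
    Integrable (fun t : Circle => poissonKernel 0 z t) ν :=
  integrable_of_continuous (continuous_poissonKernel hz) ν

/-- Poisson integrals of a measure vanishing near `ξ` tend to zero at `ξ`. -/
lemma tendsto_integral_poissonKernel_of_ball_null {ν : Measure Circle} [IsFiniteMeasure ν]
    {ξ : Circle} {r : ℝ} (hr : 0 < r) (hν : ν (Metric.ball ξ r) = 0) :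
    Tendsto (fun z => ∫ t : Circle, poissonKernel 0 z t ∂ν) (𝓝[Metric.ball 0 1] (ξ : ℂ))
      (𝓝 0) := by
  have hlim : Tendsto (fun z : ℂ => 8 * (1 - ‖z‖) / r ^ 2 * ν.real univ)
      (𝓝[Metric.ball 0 1] (ξ : ℂ)) (𝓝 0) := by
    have : Continuous fun z : ℂ => 8 * (1 - ‖z‖) / r ^ 2 * ν.real univ := by fun_prop
    have h := this.tendsto (ξ : ℂ)
    rw [Circle.norm_coe, sub_self, mul_zero, zero_div, zero_mul] at h
    exact h.mono_left nhdsWithin_le_nhds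
  have hball : ∀ᶠ z in 𝓝[Metric.ball 0 1] (ξ : ℂ), z ∈ Metric.ball (ξ : ℂ) (r / 2) :=
    nhdsWithin_le_nhds (Metric.ball_mem_nhds _ (by positivity))
  refine squeeze_zero' ?_ ?_ hlim
  · filter_upwards [eventually_norm_lt_one le_rfl] with z hz
    exact integral_nonneg fun t => poissonKernel_nonneg t hz
  · filter_upwards [eventually_norm_lt_one le_rfl, hball] with z hz hzb
    rw [Metric.mem_ball, dist_eq_norm] at hzb
    have h1 : ∀ᵐ t ∂ν, poissonKernel 0 z (t : Circle) ≤ 8 * (1 - ‖z‖) / r ^ 2 := by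
      have : ∀ᵐ t ∂ν, t ∉ Metric.ball ξ r := by
        rw [ae_iff]
        simp only [not_not]
        exact hν
      filter_upwards [this] with t ht
      rw [Metric.mem_ball, not_lt, circle_dist_eq] at ht
      have h2 : r / 2 ≤ ‖(t : ℂ) - z‖ := by
        have := norm_sub_le_norm_sub_add_norm_sub (t : ℂ) z ξ
        linarith
      calc _ ≤ 2 * (1 - ‖z‖) / ‖(t : ℂ) - z‖ ^ 2 := poissonKernel_le_div t hz
        _ ≤ 2 * (1 - ‖z‖) / (r / 2) ^ 2 := by
            gcongr
        _ = _ := by field_simp; ring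
    calc _ ≤ ∫ _ : Circle, 8 * (1 - ‖z‖) / r ^ 2 ∂ν :=
          integral_mono_ae (integrable_poissonKernel hz) (integrable_const _) h1
      _ = _ := by rw [integral_const, smul_eq_mul, mul_comm]

/-- In a Stolz region `|z - ξ| ≤ C (1 - |z|) ≤ C |t - z|`, so `|t - ξ| ≤ (1 + C) |t - z|`: the
kernel has a majorant depending only on the distance from `t` to the vertex. -/
lemma poissonKernel_le_of_mem_stolz {C : ℝ} {ξ : Circle} {z : ℂ} (hz : z ∈ stolz C ξ)
    (t : Circle) :
    poissonKernel 0 z t ≤ 2 * (1 + C) ^ 2 * (1 - ‖z‖) / (max (1 - ‖z‖) (dist t ξ)) ^ 2 := by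
  have hδ : 0 < 1 - ‖z‖ := by linarith [hz.1]
  have h1 := one_sub_norm_le t z
  have hC : 0 ≤ C := by
    by_contra h
    nlinarith [hz.2, norm_nonneg (z - ξ)]
  have h2 : dist t ξ ≤ (1 + C) * ‖(t : ℂ) - z‖ := by
    rw [circle_dist_eq]
    have := norm_sub_le_norm_sub_add_norm_sub (t : ℂ) z ξ
    have := hz.2
    nlinarith
  have h3 : max (1 - ‖z‖) (dist t ξ) ≤ (1 + C) * ‖(t : ℂ) - z‖ :=
    max_le (by nlinarith) h2
  have hm : 0 < max (1 - ‖z‖) (dist t ξ) := lt_max_of_lt_left hδ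
  have h4 : 0 < ‖(t : ℂ) - z‖ := by linarith
  calc _ ≤ 2 * (1 - ‖z‖) / ‖(t : ℂ) - z‖ ^ 2 := poissonKernel_le_div t hz.1
    _ = 2 * (1 + C) ^ 2 * (1 - ‖z‖) / ((1 + C) * ‖(t : ℂ) - z‖) ^ 2 := by
        field_simp
    _ ≤ _ := by gcongr

lemma exists_dyadic_le {δ s : ℝ} (hδ : 0 < δ) :
    ∃ j : ℕ, s ≤ 2 ^ j * δ ∧ 1 / (max δ s) ^ 2 ≤ 4 / (δ ^ 2 * 4 ^ j) := by
  rcases le_total s δ with h | h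
  · refine ⟨0, by simpa using h, ?_⟩
    rw [max_eq_left h, pow_zero, mul_one]
    gcongr
    norm_num
  · obtain ⟨n, h1, h2⟩ := exists_nat_pow_near (x := s / δ) (y := 2)
      ((one_le_div hδ).2 h) one_lt_two
    rw [le_div_iff₀ hδ] at h1
    rw [div_lt_iff₀ hδ] at h2
    refine ⟨n + 1, h2.le, ?_⟩
    rw [max_eq_right h]
    calc 1 / s ^ 2 ≤ 1 / (2 ^ n * δ) ^ 2 := by gcongr
      _ = _ := by
        rw [mul_pow, ← pow_mul, mul_comm n 2, pow_mul, pow_succ]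
        norm_num
        field_simp
        ring

/-- Dyadic summation: at distance about `2^j δ` from `ξ` the kernel is at most a constant times
`4^(-j) / δ`, while the ball of that radius has mass at most `ε 2^j δ`. The products form a
geometric series with sum `16 (1 + C)² ε`. -/
lemma lintegral_poissonKernel_le {ν : Measure Circle} {ξ : Circle} {C ε : ℝ} (hε : 0 ≤ ε)
    (hν : ∀ ρ : ℝ, 0 < ρ → ν (Metric.closedBall ξ ρ) ≤ ENNReal.ofReal (ε * ρ))
    {z : ℂ} (hz : z ∈ stolz C ξ) :
    ∫⁻ t : Circle, ENNReal.ofReal (poissonKernel 0 z t) ∂ν ≤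
      ENNReal.ofReal (16 * (1 + C) ^ 2 * ε) := by
  have hδ : 0 < 1 - ‖z‖ := by linarith [hz.1]
  set δ := 1 - ‖z‖ with hδdef
  let a : ℕ → ℝ := fun j => 2 * (1 + C) ^ 2 * δ * (4 / (δ ^ 2 * 4 ^ j))
  have ha : ∀ j, 0 ≤ a j := fun j => by positivity
  have h1 : ∀ t : Circle, ENNReal.ofReal (poissonKernel 0 z t) ≤
      ∑' j : ℕ, (Metric.closedBall ξ (2 ^ j * δ)).indicator
        (fun _ => ENNReal.ofReal (a j)) t := by
    intro t
    obtain ⟨j, hj, hj'⟩ := exists_dyadic_le (s := dist t ξ) hδ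
    refine le_trans ?_ (ENNReal.le_tsum j)
    rw [indicator_of_mem (Metric.mem_closedBall.2 hj)]
    apply ENNReal.ofReal_le_ofReal
    refine (poissonKernel_le_of_mem_stolz hz t).trans ?_
    rw [div_eq_mul_one_div]
    exact mul_le_mul_of_nonneg_left hj' (by positivity)
  have hgeom : ∀ j : ℕ, a j * (ε * (2 ^ j * δ)) = 8 * (1 + C) ^ 2 * ε * (1 / 2) ^ j := by
    intro j
    have h4 : (4 : ℝ) ^ j = 2 ^ j * 2 ^ j := by rw [← mul_pow]; norm_num
    simp only [a]
    rw [h4, one_div, inv_pow]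
    field_simp
    ring
  calc _ ≤ ∫⁻ t : Circle, ∑' j : ℕ, (Metric.closedBall ξ (2 ^ j * δ)).indicator
        (fun _ => ENNReal.ofReal (a j)) t ∂ν := lintegral_mono h1
    _ = ∑' j : ℕ, ENNReal.ofReal (a j) * ν (Metric.closedBall ξ (2 ^ j * δ)) := by
        rw [lintegral_tsum fun j => (measurable_const.indicator
          Metric.isClosed_closedBall.measurableSet).aemeasurable]
        congr 1 with j
        rw [lintegral_indicator_const Metric.isClosed_closedBall.measurableSet]
    _ ≤ ∑' j : ℕ, ENNReal.ofReal (8 * (1 + C) ^ 2 * ε * (1 / 2) ^ j) := by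
        refine ENNReal.tsum_le_tsum fun j => ?_
        rw [← hgeom, ENNReal.ofReal_mul (ha j)]
        exact mul_le_mul_right (hν _ (by positivity)) _
    _ = _ := by
        rw [← ENNReal.ofReal_tsum_of_nonneg (fun j => by positivity)
          (summable_geometric_two.mul_left _), tsum_mul_left, tsum_geometric_two]
        ring_nf

/-- If `ν` has vanishing density at `ξ`, its Poisson integral tends to zero nontangentially. -/
lemma tendsto_integral_poissonKernel_of_density_zero {ν : Measure Circle} [IsFiniteMeasure ν]
    {ξ : Circle}
    (hν : Tendsto (fun r : ℝ => ν.real (Metric.closedBall ξ r) / r) (𝓝[>] 0) (𝓝 0)) (C : ℝ) :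
    Tendsto (fun z => ∫ t : Circle, poissonKernel 0 z t ∂ν) (𝓝[stolz C ξ] (ξ : ℂ)) (𝓝 0) := by
  rw [Metric.tendsto_nhds]
  intro η hη
  set K := 16 * (1 + C) ^ 2 with hK
  have hK0 : 0 ≤ K := by positivity
  set ε := η / (2 * (K + 1)) with hεdef
  have hε : 0 < ε := by positivity
  obtain ⟨r, hr, hrε⟩ : ∃ r > 0, ∀ ρ : ℝ, 0 < ρ → ρ ≤ r →
      ν (Metric.closedBall ξ ρ) ≤ ENNReal.ofReal (ε * ρ) := by
    have h := hν.eventually (Iio_mem_nhds hε)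
    obtain ⟨r, hr, h⟩ := mem_nhdsGT_iff_exists_Ioc_subset.1 h
    refine ⟨r, hr, fun ρ h0 h1 => ?_⟩
    have h2 : ν.real (Metric.closedBall ξ ρ) / ρ < ε := h ⟨h0, h1⟩
    rw [div_lt_iff₀ h0] at h2
    rw [← ofReal_measureReal]
    exact ENNReal.ofReal_le_ofReal h2.le
  set B := Metric.closedBall ξ r
  have hB : MeasurableSet B := Metric.isClosed_closedBall.measurableSet
  -- Restricting `ν` to `B` extends the linear bound on masses of balls from radii `ρ ≤ r` to all
  -- radii.
  have hnear : ∀ z ∈ stolz C ξ, ∫ t in B, poissonKernel 0 z t ∂ν ≤ K * ε := by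
    intro z hz
    rw [integral_eq_lintegral_of_nonneg_ae (.of_forall fun t => poissonKernel_nonneg t hz.1)
      (continuous_poissonKernel hz.1).aestronglyMeasurable]
    refine ENNReal.toReal_le_of_le_ofReal (by positivity) ?_
    refine lintegral_poissonKernel_le hε.le (fun ρ hρ => ?_) hz
    rcases le_total ρ r with h | h
    · exact (Measure.restrict_apply_le _ _).trans (hrε ρ hρ h)
    · calc _ ≤ (ν.restrict B) univ := measure_mono (subset_univ _)
        _ = ν B := by simp
        _ ≤ _ := (hrε r hr le_rfl).trans (ENNReal.ofReal_le_ofReal (by gcongr))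
  have hfar : Tendsto (fun z => ∫ t in Bᶜ, poissonKernel 0 z t ∂ν) (𝓝[stolz C ξ] (ξ : ℂ))
      (𝓝 0) := by
    refine (tendsto_integral_poissonKernel_of_ball_null (ν := ν.restrict Bᶜ) hr ?_).mono_left
      (nhdsWithin_stolz_le C ξ)
    rw [Measure.restrict_apply Metric.isOpen_ball.measurableSet]
    have : Metric.ball ξ r ∩ Bᶜ = ∅ := by
      rw [← sdiff_eq, sdiff_eq_empty]
      exact Metric.ball_subset_closedBall
    rw [this, measure_empty]
  filter_upwards [self_mem_nhdsWithin, hfar.eventually (Iio_mem_nhds (half_pos hη))]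
    with z hz hz2
  have h0 : 0 ≤ ∫ t : Circle, poissonKernel 0 z t ∂ν :=
    integral_nonneg fun t => poissonKernel_nonneg t hz.1
  rw [Real.dist_0_eq_abs, abs_of_nonneg h0,
    ← integral_add_compl hB (integrable_poissonKernel hz.1)]
  have h1 := hnear z hz
  have h2 : K * ε ≤ η / 2 := by
    rw [hεdef]
    field_simp
    linarith
  have h3 : ∫ t in Bᶜ, poissonKernel 0 z t ∂ν < η / 2 := hz2
  linarith

lemma integral_withDensity_ofReal {k : Circle → ℝ} (hk : Integrable k m) (hk0 : ∀ t, 0 ≤ k t)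
    (F : Circle → ℝ) :
    ∫ t, F t ∂(m.withDensity fun t => ENNReal.ofReal (k t)) = ∫ t, F t * k t ∂m := by
  rw [integral_withDensity_eq_integral_toReal_smul₀ hk.aemeasurable.ennreal_ofReal
    (.of_forall fun t => ENNReal.ofReal_lt_top)]
  refine integral_congr_ae (.of_forall fun t => ?_)
  simp only [ENNReal.toReal_ofReal (hk0 t), smul_eq_mul, mul_comm]

lemma integral_poissonKernel_withDensity {k : Circle → ℝ} (hk : Integrable k m)
    (hk0 : ∀ t, 0 ≤ k t) (z : ℂ) :
    ∫ t : Circle, poissonKernel 0 z t ∂(m.withDensity fun t => ENNReal.ofReal (k t)) =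
      ∫ t : Circle, poissonKernel 0 z t * k t ∂m :=
  integral_withDensity_ofReal hk hk0 _

lemma measureReal_withDensity {k : Circle → ℝ} (hk : Integrable k m)
    (hk0 : ∀ t, 0 ≤ k t) {S : Set Circle} (hS : MeasurableSet S) :
    (m.withDensity fun t => ENNReal.ofReal (k t)).real S = ∫ t in S, k t ∂m := by
  rw [measureReal_def, withDensity_apply _ hS,
    integral_eq_lintegral_of_nonneg_ae (.of_forall hk0) hk.integrableOn.aestronglyMeasurable]

lemma tendsto_integral_poissonKernel_mul_of_average {k : Circle → ℝ} (hk : Integrable k m)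
    (hk0 : ∀ t, 0 ≤ k t) {ξ : Circle}
    (h : Tendsto (fun r : ℝ => (∫ t in Metric.closedBall ξ r, k t ∂m) / r) (𝓝[>] 0) (𝓝 0))
    (C : ℝ) :
    Tendsto (fun z => ∫ t : Circle, poissonKernel 0 z t * k t ∂m) (𝓝[stolz C ξ] (ξ : ℂ))
      (𝓝 0) := by
  simp_rw [← integral_poissonKernel_withDensity hk hk0]
  have := isFiniteMeasure_withDensity_ofReal hk.2
  refine tendsto_integral_poissonKernel_of_density_zero ?_ C
  simp_rw [measureReal_withDensity hk hk0 Metric.isClosed_closedBall.measurableSet]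
  exact h

/-- Continuity at `ξ` dispenses with the Stolz region: near `ξ` the unit mass of the kernel
suffices, and the rest of `k` vanishes near `ξ`. This serves the first alternative of the theorem,
where nodes may approach the circle tangentially. -/
lemma tendsto_integral_poissonKernel_mul_of_continuousAt {k : Circle → ℝ} (hk : Integrable k m)
    (hk0 : ∀ t, 0 ≤ k t) {ξ : Circle} (h : Tendsto k (𝓝 ξ) (𝓝 0)) :
    Tendsto (fun z => ∫ t : Circle, poissonKernel 0 z t * k t ∂m)
      (𝓝[Metric.ball 0 1] (ξ : ℂ)) (𝓝 0) := by
  rw [Metric.tendsto_nhds]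
  intro η hη
  obtain ⟨r, hr, hrη⟩ := Metric.eventually_nhds_iff_ball.1 (h.eventually (Iio_mem_nhds
    (half_pos hη)))
  set B := Metric.ball ξ r
  have hB : MeasurableSet B := Metric.isOpen_ball.measurableSet
  have hkB : Integrable (Bᶜ.indicator k) m := hk.indicator hB.compl
  have hkB0 : ∀ t, 0 ≤ Bᶜ.indicator k t := fun t => indicator_nonneg (fun t _ => hk0 t) t
  have hfar : Tendsto (fun z => ∫ t : Circle, poissonKernel 0 z t * Bᶜ.indicator k t ∂m)
      (𝓝[Metric.ball 0 1] (ξ : ℂ)) (𝓝 0) := by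
    simp_rw [← integral_poissonKernel_withDensity hkB hkB0]
    have := isFiniteMeasure_withDensity_ofReal hkB.2
    refine tendsto_integral_poissonKernel_of_ball_null hr ?_
    rw [withDensity_apply _ hB, setLIntegral_eq_zero_iff' hB
      hkB.aemeasurable.ennreal_ofReal.restrict]
    refine .of_forall fun t ht => ?_
    rw [indicator_of_notMem (by simpa using ht), ENNReal.ofReal_zero]
  filter_upwards [eventually_norm_lt_one le_rfl, hfar.eventually (Iio_mem_nhds (half_pos hη))]
    with z hz hz2
  have h0 : 0 ≤ ∫ t : Circle, poissonKernel 0 z t * k t ∂m :=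
    integral_nonneg fun t => mul_nonneg (poissonKernel_nonneg t hz) (hk0 t)
  rw [Real.dist_0_eq_abs, abs_of_nonneg h0]
  have hz2' : ∫ t : Circle, poissonKernel 0 z t * Bᶜ.indicator k t ∂m < η / 2 := hz2
  calc _ ≤ ∫ t : Circle, (poissonKernel 0 z t * (η / 2)
        + poissonKernel 0 z t * Bᶜ.indicator k t) ∂m := by
        refine integral_mono (integrable_poissonKernel_mul hk hz)
          (((integrable_poissonKernel hz).mul_const _).add
            (integrable_poissonKernel_mul hkB hz)) fun t => ?_
        simp only
        rw [← mul_add]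
        refine mul_le_mul_of_nonneg_left ?_ (poissonKernel_nonneg t hz)
        by_cases ht : t ∈ B
        · have : k t < η / 2 := hrη t ht
          linarith [hkB0 t]
        · rw [indicator_of_mem (show t ∈ Bᶜ from ht)]
          linarith
    _ = η / 2 + ∫ t : Circle, poissonKernel 0 z t * Bᶜ.indicator k t ∂m := by
        rw [integral_add ((integrable_poissonKernel hz).mul_const _)
            (integrable_poissonKernel_mul hkB hz), integral_mul_const,
          integral_poissonKernel hz, one_mul]
    _ < η := by linarith

lemma tendsto_integral_poissonKernel_smul {E : Type*} [NormedAddCommGroup E] [NormedSpace ℝ E]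
    [CompleteSpace E] {g : Circle → E} (hg : Integrable g m) {L : E} {l : Filter ℂ} {ξ : Circle}
    (hl : l ≤ 𝓝[Metric.ball 0 1] (ξ : ℂ))
    (h : Tendsto (fun z => ∫ t : Circle, poissonKernel 0 z t * ‖g t - L‖ ∂m) l (𝓝 0)) :
    Tendsto (fun z => ∫ t : Circle, poissonKernel 0 z t • g t ∂m) l (𝓝 L) := by
  rw [tendsto_iff_norm_sub_tendsto_zero]
  refine squeeze_zero' (.of_forall fun _ => norm_nonneg _) ?_ h
  filter_upwards [eventually_norm_lt_one hl] with z hz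
  have hgL : Integrable (fun t => g t - L) m := hg.sub (integrable_const L)
  have : (∫ t : Circle, poissonKernel 0 z t • g t ∂m) - L =
      ∫ t : Circle, poissonKernel 0 z t • (g t - L) ∂m := by
    simp_rw [smul_sub]
    rw [integral_sub (integrable_poissonKernel_smul hg hz)
      (integrable_poissonKernel_smul (integrable_const L) hz), integral_smul_const,
      integral_poissonKernel hz, one_smul]
  rw [this]
  refine (norm_integral_le_integral_norm _).trans (le_of_eq ?_)
  refine integral_congr_ae (.of_forall fun t => ?_)
  simp only [norm_smul, Real.norm_of_nonneg (poissonKernel_nonneg t hz)]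

lemma m_real_closedBall_le (ξ : Circle) {r : ℝ} (hr : 0 ≤ r) :
    m.real (Metric.closedBall ξ r) ≤ 3 / 2 * r :=
  ENNReal.toReal_le_of_le_ofReal (by positivity) (m_closedBall_le ξ hr)

lemma tendsto_closedBall_average_of_isLebesguePoint {h : Circle → ℝ} (hh : Integrable h m)
    {ξ : Circle} (hξ : IsLebesguePoint h ξ) :
    Tendsto (fun r : ℝ => (∫ t in Metric.closedBall ξ r, ‖h t - h ξ‖ ∂m) / r) (𝓝[>] 0)
      (𝓝 0) := by
  have h2 : Tendsto (fun r : ℝ => 2 * r) (𝓝[>] 0) (𝓝[>] 0) := by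
    refine tendsto_nhdsWithin_iff.2 ⟨?_, ?_⟩
    · have : Tendsto (fun r : ℝ => 2 * r) (𝓝 0) (𝓝 (2 * 0)) :=
        tendsto_id.const_mul 2
      rw [mul_zero] at this
      exact this.mono_left nhdsWithin_le_nhds
    · filter_upwards [self_mem_nhdsWithin] with r hr
      have : (0 : ℝ) < r := hr
      simpa using this
  -- Lebesgue points are stated with open balls. The closed ball of radius `r` lies in the open ball
  -- of radius `2r`, whose measure is at most `3r`.
  have h3 := (hξ.comp h2).const_mul 3
  rw [mul_zero] at h3
  refine squeeze_zero' ?_ ?_ h3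
  · filter_upwards [self_mem_nhdsWithin] with r hr
    exact div_nonneg (integral_nonneg fun t => norm_nonneg _) (le_of_lt hr)
  · filter_upwards [self_mem_nhdsWithin] with r hr
    have hr : 0 < r := hr
    rw [div_le_iff₀ hr]
    have hi : Integrable (fun t => ‖h t - h ξ‖) m := (hh.sub (integrable_const _)).norm
    calc _ ≤ ∫ t in Metric.ball ξ (2 * r), ‖h t - h ξ‖ ∂m :=
          setIntegral_mono_set hi.integrableOn (.of_forall fun t => norm_nonneg _)
            (Metric.closedBall_subset_ball (by linarith)).eventuallyLE
      _ = m.real (Metric.ball ξ (2 * r)) * ⨍ t in Metric.ball ξ (2 * r), |h t - h ξ| ∂m := by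
          rw [← smul_eq_mul (m.real _), measure_smul_setAverage _ (measure_ne_top _ _)]
          rfl
      _ ≤ (3 / 2 * (2 * r)) * ⨍ t in Metric.ball ξ (2 * r), |h t - h ξ| ∂m := by
          refine mul_le_mul_of_nonneg_right ?_ ?_
          · exact (measureReal_mono Metric.ball_subset_closedBall).trans
              (m_real_closedBall_le ξ (by linarith))
          · rw [setAverage_eq]
            exact smul_nonneg (by positivity) (integral_nonneg fun t => abs_nonneg _)
      _ = _ := by simp only [Function.comp]; ring

lemma tendsto_closedBall_filterAt_self (ξ : Circle) :
    Tendsto (fun r : ℝ => Metric.closedBall ξ r) (𝓝[>] 0)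
      ((IsUnifLocDoublingMeasure.vitaliFamily m 1).filterAt ξ) := by
  refine IsUnifLocDoublingMeasure.tendsto_closedBall_filterAt m (fun _ => ξ) id tendsto_id ?_
  filter_upwards [self_mem_nhdsWithin] with r hr
  exact Metric.mem_closedBall_self (by simpa using le_of_lt hr)

lemma ae_tendsto_closedBall_average {E : Type*} [NormedAddCommGroup E] {g : Circle → E}
    (hg : Integrable g m) : ∀ᵐ ξ : Circle ∂m,
    Tendsto (fun r : ℝ => (∫ t in Metric.closedBall ξ r, ‖g t - g ξ‖ ∂m) / r) (𝓝[>] 0)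
      (𝓝 0) := by
  filter_upwards [(IsUnifLocDoublingMeasure.vitaliFamily m 1).ae_tendsto_average_norm_sub
    hg.locallyIntegrable] with ξ hξ
  have h3 := (hξ.comp (tendsto_closedBall_filterAt_self ξ)).const_mul (3 / 2)
  rw [mul_zero] at h3
  refine squeeze_zero' ?_ ?_ h3
  · filter_upwards [self_mem_nhdsWithin] with r hr
    exact div_nonneg (integral_nonneg fun t => norm_nonneg _) (le_of_lt hr)
  · filter_upwards [self_mem_nhdsWithin] with r hr
    have hr : 0 < r := hr
    rw [div_le_iff₀ hr]
    calc _ = m.real (Metric.closedBall ξ r) * ⨍ t in Metric.closedBall ξ r, ‖g t - g ξ‖ ∂m := by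
          rw [← smul_eq_mul, measure_smul_setAverage _ (measure_ne_top _ _)]
      _ ≤ (3 / 2 * r) * ⨍ t in Metric.closedBall ξ r, ‖g t - g ξ‖ ∂m := by
          refine mul_le_mul_of_nonneg_right (m_real_closedBall_le ξ hr.le) ?_
          rw [setAverage_eq]
          exact smul_nonneg (by positivity) (integral_nonneg fun t => norm_nonneg _)
      _ = _ := by simp only [Function.comp]; ring

/-- **Fatou's theorem** for Poisson integrals of integrable functions. -/
lemma ae_tendsto_integral_poissonKernel_smul {E : Type*} [NormedAddCommGroup E]
    [NormedSpace ℝ E] [CompleteSpace E] {g : Circle → E} (hg : Integrable g m) :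
    ∀ᵐ ξ : Circle ∂m, ∀ C : ℝ, Tendsto (fun z => ∫ t : Circle, poissonKernel 0 z t • g t ∂m)
      (𝓝[stolz C ξ] (ξ : ℂ)) (𝓝 (g ξ)) := by
  filter_upwards [ae_tendsto_closedBall_average hg] with ξ hξ C
  exact tendsto_integral_poissonKernel_smul hg (nhdsWithin_stolz_le C ξ)
    (tendsto_integral_poissonKernel_mul_of_average (hg.sub (integrable_const _)).norm
      (fun t => norm_nonneg _) hξ C)

/-- The derivative of `ν` along the Vitali family is its Radon-Nikodym density, which is `0` for a
singular measure; two-sided bounds on `m` of balls turn this into vanishing density with respect to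
the radius. -/
lemma ae_tendsto_integral_poissonKernel_of_mutuallySingular {ν : Measure Circle}
    [IsFiniteMeasure ν] (hν : ν ⟂ₘ m) :
    ∀ᵐ ξ : Circle ∂m, ∀ C : ℝ, Tendsto (fun z => ∫ t : Circle, poissonKernel 0 z t ∂ν)
      (𝓝[stolz C ξ] (ξ : ℂ)) (𝓝 0) := by
  filter_upwards [(IsUnifLocDoublingMeasure.vitaliFamily m 1).ae_tendsto_rnDeriv ν,
    hν.rnDeriv_ae_eq_zero] with ξ hξ h0 C
  refine tendsto_integral_poissonKernel_of_density_zero ?_ C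
  rw [h0] at hξ
  have h1 := (ENNReal.tendsto_toReal ENNReal.zero_ne_top).comp
    (hξ.comp (tendsto_closedBall_filterAt_self ξ))
  have h3 := h1.const_mul (3 / 2)
  simp only [ENNReal.toReal_zero, mul_zero] at h3
  refine squeeze_zero' ?_ ?_ h3
  · filter_upwards [self_mem_nhdsWithin] with r hr
    exact div_nonneg measureReal_nonneg (le_of_lt hr)
  · filter_upwards [Ioo_mem_nhdsGT Real.pi_pos] with r hr
    have hr0 : 0 < r := hr.1
    have hpos : 0 < m.real (Metric.closedBall ξ r) :=
      ENNReal.toReal_pos ((ENNReal.ofReal_pos.2 (by positivity)).trans_le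
        (le_m_closedBall ξ hr0.le hr.2.le)).ne' (measure_ne_top _ _)
    have hle := m_real_closedBall_le ξ hr0.le
    simp only [Function.comp, ENNReal.toReal_div]
    change _ ≤ 3 / 2 * (ν.real _ / m.real _)
    rw [div_le_iff₀ hr0]
    calc ν.real (Metric.closedBall ξ r) = ν.real (Metric.closedBall ξ r) /
          m.real (Metric.closedBall ξ r) * m.real (Metric.closedBall ξ r) := by field_simp
      _ ≤ ν.real (Metric.closedBall ξ r) / m.real (Metric.closedBall ξ r) * (3 / 2 * r) := by
          gcongr
      _ = _ := by ring

/-! ### The Lebesgue decomposition of a Poisson integral -/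

lemma density_nonneg (μ : Measure Circle) (t : Circle) : 0 ≤ density μ t := ENNReal.toReal_nonneg

lemma integrable_density (μ : Measure Circle) [IsFiniteMeasure μ] : Integrable (density μ) m :=
  Measure.integrable_toReal_rnDeriv

lemma integral_eq_singularPart_add (μ : Measure Circle) [IsFiniteMeasure μ] {F : Circle → ℝ}
    (hF : Integrable F μ) :
    ∫ t, F t ∂μ = ∫ t, F t ∂(μ.singularPart m) + ∫ t, F t * density μ t ∂m := by
  have h := Measure.haveLebesgueDecomposition_add μ m
  have hF' := hF
  rw [h] at hF'
  conv_lhs => rw [h]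
  rw [integral_add_measure hF'.left_of_add_measure hF'.right_of_add_measure,
    integral_withDensity_eq_integral_toReal_smul (Measure.measurable_rnDeriv _ _)
      (Measure.rnDeriv_lt_top _ _)]
  simp only [smul_eq_mul, mul_comm, density]

/-- **Fatou's theorem** for Poisson integrals of measures. -/
lemma ae_tendsto_integral_poissonKernel_density (μ : Measure Circle) [IsFiniteMeasure μ] :
    ∀ᵐ ξ : Circle ∂m, ∀ C : ℝ, Tendsto (fun z => ∫ t : Circle, poissonKernel 0 z t ∂μ)
      (𝓝[stolz C ξ] (ξ : ℂ)) (𝓝 (density μ ξ)) := by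
  filter_upwards [ae_tendsto_integral_poissonKernel_smul (integrable_density μ),
    ae_tendsto_integral_poissonKernel_of_mutuallySingular (Measure.mutuallySingular_singularPart μ m)]
    with ξ h1 h2 C
  have := (h2 C).add (h1 C)
  rw [zero_add] at this
  refine this.congr' ?_
  filter_upwards [self_mem_nhdsWithin] with z hz
  rw [integral_eq_singularPart_add μ (integrable_poissonKernel hz.1)]
  rfl

/-! ### Boundary values of bounded holomorphic functions -/

/-- A sequence of radii in `(0, 1)` tending to `1`. -/
def radius (n : ℕ) : ℝ := 1 - 1 / ((n : ℝ) + 2)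

lemma radius_pos (n : ℕ) : 0 < radius n := by
  have : (0 : ℝ) < (n : ℝ) + 2 := by positivity
  rw [radius, sub_pos, div_lt_one this]
  linarith [(Nat.cast_nonneg n : (0 : ℝ) ≤ n)]

lemma radius_lt_one (n : ℕ) : radius n < 1 := by
  have : (0 : ℝ) < 1 / ((n : ℝ) + 2) := by positivity
  rw [radius]
  linarith

lemma norm_radius (n : ℕ) : ‖(radius n : ℂ)‖ = radius n := by
  rw [Complex.norm_real, Real.norm_of_nonneg (radius_pos n).le]

lemma tendsto_radius : Tendsto radius atTop (𝓝 1) := by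
  have h : Tendsto (fun n : ℕ => (n : ℝ) + 2) atTop atTop :=
    tendsto_atTop_add_const_right _ _ tendsto_natCast_atTop_atTop
  have := (h.const_div_atTop 1).const_sub 1
  rw [sub_zero] at this
  exact this

lemma tendsto_radius_mul (z : ℂ) : Tendsto (fun n => (radius n : ℂ) * z) atTop (𝓝 z) := by
  have := ((Complex.continuous_ofReal.tendsto 1).comp tendsto_radius).mul_const z
  simpa using this

lemma norm_radius_mul_lt {z : ℂ} (hz : ‖z‖ ≤ 1) (n : ℕ) : ‖(radius n : ℂ) * z‖ < 1 := by
  rw [norm_mul, norm_radius]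
  nlinarith [radius_pos n, radius_lt_one n]

lemma radius_mul_mem_stolz (ξ : Circle) (n : ℕ) : (radius n : ℂ) * ξ ∈ stolz 1 ξ := by
  refine ⟨norm_radius_mul_lt (Circle.norm_coe ξ).le n, ?_⟩
  have : (radius n : ℂ) * ξ - ξ = ((radius n - 1 : ℝ) : ℂ) * ξ := by push_cast; ring
  rw [this, norm_mul, norm_mul, Circle.norm_coe, norm_radius, Complex.norm_real, Real.norm_eq_abs,
    abs_of_nonpos (by linarith [radius_lt_one n])]
  linarith

lemma tendsto_radius_stolz (ξ : Circle) :
    Tendsto (fun n => (radius n : ℂ) * ξ) atTop (𝓝[stolz 1 ξ] (ξ : ℂ)) :=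
  tendsto_nhdsWithin_iff.2 ⟨tendsto_radius_mul ξ, .of_forall (radius_mul_mem_stolz ξ)⟩

lemma tendsto_radius_nontangential (ξ : Circle) :
    Tendsto (fun n => (radius n : ℂ) * ξ) atTop (nontangential ξ) :=
  (tendsto_radius_stolz ξ).mono_right (le_iSup (fun C => 𝓝[stolz C ξ] (ξ : ℂ)) 1)

instance nontangential_neBot (ξ : Circle) : (nontangential ξ).NeBot :=
  (tendsto_radius_nontangential ξ).neBot

lemma diffContOnCl_comp_mul {f : ℂ → ℂ} (hf : DifferentiableOn ℂ f (Metric.ball 0 1)) (n : ℕ) :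
    DiffContOnCl ℂ (fun z => f (radius n * z)) (Metric.ball 0 1) := by
  refine DifferentiableOn.diffContOnCl ?_
  rw [closure_ball _ one_ne_zero]
  refine hf.comp (by fun_prop) fun z hz => ?_
  rw [mem_ball_zero_iff]
  exact norm_radius_mul_lt (by simpa using hz) n

lemma continuous_dilation {f : ℂ → ℂ} (hf : DifferentiableOn ℂ f (Metric.ball 0 1)) (n : ℕ) :
    Continuous fun t : Circle => f (radius n * t) := by
  refine hf.continuousOn.comp_continuous (by fun_prop) fun t => ?_
  rw [mem_ball_zero_iff]
  exact norm_radius_mul_lt (Circle.norm_coe t).le n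

lemma tendsto_dilation {f : ℂ → ℂ} (hf : DifferentiableOn ℂ f (Metric.ball 0 1)) {z : ℂ}
    (hz : ‖z‖ < 1) : Tendsto (fun n => f (radius n * z)) atTop (𝓝 (f z)) := by
  have : ContinuousAt f z :=
    hf.continuousOn.continuousAt (Metric.isOpen_ball.mem_nhds (by simpa using hz))
  exact this.tendsto.comp (tendsto_radius_mul z)

/-- A Schur function is the Poisson integral of a square integrable function. -/
lemma IsSchur.exists_boundary {f : ℂ → ℂ} (hf : IsSchur f) :
    ∃ g : Circle → ℂ, Integrable g m ∧
      ∀ z : ℂ, ‖z‖ < 1 → ∫ t : Circle, poissonKernel 0 z t • g t ∂m = f z := by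
  have hmem : ∀ F : Circle → ℂ, Continuous F → MemLp F 2 m := fun F hF =>
    (hF.memLp_of_hasCompactSupport (HasCompactSupport.of_compactSpace F))
  let φ : ℕ → Lp ℂ 2 m := fun n => (hmem _ (continuous_dilation hf.1 n)).toLp _
  have hφ : ∀ n, ‖φ n‖ ≤ 1 := by
    intro n
    rw [Lp.norm_toLp]
    refine ENNReal.toReal_le_of_le_ofReal zero_le_one ?_
    refine (eLpNorm_le_of_ae_bound (C := 1) (.of_forall fun t => ?_)).trans ?_
    · exact hf.2 _ (by
        rw [mem_ball_zero_iff]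
        exact norm_radius_mul_lt (Circle.norm_coe t).le n)
    · simp
  -- The dilations are bounded in `L²`, so Banach-Alaoglu gives a weak limit. A limit along an
  -- ultrafilter replaces the extraction of a subsequence.
  let T : ℕ → WeakDual ℂ (Lp ℂ 2 m) := fun n =>
    StrongDual.toWeakDual (InnerProductSpace.toDual ℂ (Lp ℂ 2 m) (φ n))
  have hcomp := WeakDual.isCompact_closedBall (𝕜 := ℂ) (E := Lp ℂ 2 m) 0 1
  let U : Ultrafilter ℕ := Filter.hyperfilter ℕ
  have hU : (U : Filter ℕ) ≤ atTop := Nat.hyperfilter_le_atTop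
  obtain ⟨S, -, hS⟩ := hcomp.ultrafilter_le_nhds' (U.map T) (by
    refine Ultrafilter.mem_map.2 (Filter.mem_of_superset Filter.univ_mem fun n _ => ?_)
    simp only [mem_preimage, mem_closedBall_zero_iff]
    refine le_trans (le_of_eq ?_) (hφ n)
    exact (InnerProductSpace.toDual ℂ (Lp ℂ 2 m)).norm_map (φ n))
  let g : Lp ℂ 2 m := (InnerProductSpace.toDual ℂ (Lp ℂ 2 m)).symm (WeakDual.toStrongDual S)
  have hlim : ∀ ψ : Lp ℂ 2 m,
      Tendsto (fun n => inner ℂ (φ n) ψ) U (𝓝 (inner ℂ g ψ)) := by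
    intro ψ
    have h1 : Tendsto (fun n => T n ψ) U (𝓝 (S ψ)) :=
      ((WeakDual.eval_continuous ψ).tendsto S).comp hS
    have h2 : inner ℂ g ψ = S ψ := by
      simp only [g, InnerProductSpace.toDual_symm_apply]
      rfl
    rw [h2]
    exact h1
  refine ⟨g, (Lp.memLp g).integrable (by norm_num), fun z hz => ?_⟩
  have hP : MemLp (fun t : Circle => (poissonKernel 0 z t : ℂ)) 2 m :=
    hmem _ (Complex.continuous_ofReal.comp (continuous_poissonKernel hz))
  have hinner : ∀ G : Lp ℂ 2 m, (starRingEnd ℂ) (inner ℂ G (hP.toLp _)) =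
      ∫ t : Circle, poissonKernel 0 z t • G t ∂m := by
    intro G
    rw [inner_conj_symm, L2.inner_def]
    refine integral_congr_ae ?_
    filter_upwards [hP.coeFn_toLp] with t ht
    rw [ht]
    simp [mul_comm]
  have h1 := (Complex.continuous_conj.tendsto _).comp (hlim (hP.toLp _))
  simp only [Function.comp_def, hinner] at h1
  have h2 : ∀ n, ∫ t : Circle, poissonKernel 0 z t • (φ n) t ∂m = f (radius n * z) := by
    intro n
    rw [← integral_poissonKernel_smul (diffContOnCl_comp_mul hf.1 n) hz]
    refine integral_congr_ae ?_
    filter_upwards [(hmem _ (continuous_dilation hf.1 n)).coeFn_toLp] with t ht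
    rw [ht]
  simp only [h2] at h1
  exact tendsto_nhds_unique h1 ((tendsto_dilation hf.1 hz).mono_left hU)

/-- **Fatou's theorem** for bounded holomorphic functions. -/
lemma IsSchur.ae_tendsto_trace {f : ℂ → ℂ} (hf : IsSchur f) :
    ∀ᵐ ξ : Circle ∂m, Tendsto f (nontangential ξ) (𝓝 (trace f ξ)) := by
  obtain ⟨g, hg, hgf⟩ := hf.exists_boundary
  filter_upwards [ae_tendsto_integral_poissonKernel_smul hg] with ξ hξ
  have : Tendsto f (nontangential ξ) (𝓝 (g ξ)) := by
    refine tendsto_iSup.2 fun C => (hξ C).congr' ?_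
    filter_upwards [self_mem_nhdsWithin] with z hz using hgf z hz.1
  rw [trace, this.limUnder_eq]
  exact this

lemma IsSchur.ae_tendsto_dilation {f : ℂ → ℂ} (hf : IsSchur f) :
    ∀ᵐ ξ : Circle ∂m, Tendsto (fun n => f (radius n * ξ)) atTop (𝓝 (trace f ξ)) := by
  filter_upwards [hf.ae_tendsto_trace] with ξ hξ
  exact hξ.comp (tendsto_radius_nontangential ξ)

lemma IsSchur.aestronglyMeasurable_trace {f : ℂ → ℂ} (hf : IsSchur f) :
    AEStronglyMeasurable (fun t : Circle => trace f t) m :=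
  aestronglyMeasurable_of_tendsto_ae atTop
    (fun n => (continuous_dilation hf.1 n).aestronglyMeasurable) hf.ae_tendsto_dilation

lemma IsSchur.integral_poissonKernel_smul_radial {h : ℂ → ℂ} (hh : IsSchur h) {H : Circle → ℂ}
    (hH : ∀ᵐ t : Circle ∂m, Tendsto (fun n => h (radius n * t)) atTop (𝓝 (H t))) {z : ℂ}
    (hz : ‖z‖ < 1) : ∫ t : Circle, poissonKernel 0 z t • H t ∂m = h z := by
  have h1 : Tendsto (fun n => ∫ t : Circle, poissonKernel 0 z t • h (radius n * t) ∂m) atTop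
      (𝓝 (∫ t : Circle, poissonKernel 0 z t • H t ∂m)) := by
    refine tendsto_integral_of_dominated_convergence (fun t : Circle => poissonKernel 0 z t)
      (fun n => ((continuous_poissonKernel hz).smul
        (continuous_dilation hh.1 n)).aestronglyMeasurable) (integrable_poissonKernel hz)
      (fun n => .of_forall fun t => ?_) ?_
    · rw [norm_smul, Real.norm_of_nonneg (poissonKernel_nonneg t hz)]
      refine mul_le_of_le_one_right (poissonKernel_nonneg t hz) (hh.2 _ ?_)
      rw [mem_ball_zero_iff]
      exact norm_radius_mul_lt (Circle.norm_coe t).le n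
    · filter_upwards [hH] with t ht using ht.const_smul _
  have h2 : ∀ n, ∫ t : Circle, poissonKernel 0 z t • h (radius n * t) ∂m = h (radius n * z) :=
    fun n => integral_poissonKernel_smul (diffContOnCl_comp_mul hh.1 n) hz
  simp only [h2] at h1
  exact tendsto_nhds_unique h1 (tendsto_dilation hh.1 hz)

/-! ### The real part of the Cayley transform -/

/-- The real part of `(1 + w) / (1 - w)`. -/
def cayleyRe (w : ℂ) : ℝ := (1 - ‖w‖ ^ 2) / ‖1 - w‖ ^ 2

lemma re_cayley (w : ℂ) : ((1 + w) / (1 - w)).re = cayleyRe w := by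
  have := poissonKernel_re_eq 1 w
  rw [poissonKernel_circle] at this
  simpa [cayleyRe] using this

lemma one_sub_ne_zero_of_norm_lt {w : ℂ} (hw : ‖w‖ < 1) : 1 - w ≠ 0 := by
  simpa using circle_sub_ne_zero 1 hw

lemma cayleyRe_pos {w : ℂ} (hw : ‖w‖ < 1) : 0 < cayleyRe w := by
  have : ‖w‖ ^ 2 < 1 := pow_lt_one₀ (norm_nonneg _) hw two_ne_zero
  exact div_pos (by linarith) (pow_pos (norm_pos_iff.2 (one_sub_ne_zero_of_norm_lt hw)) 2)

lemma continuousAt_cayleyRe {w : ℂ} (hw : ‖w‖ < 1) : ContinuousAt cayleyRe w := by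
  unfold cayleyRe
  refine ContinuousAt.div (by fun_prop) (by fun_prop) ?_
  exact pow_ne_zero 2 (norm_ne_zero_iff.2 (one_sub_ne_zero_of_norm_lt hw))

lemma integral_poissonKernel_mul_cayleyRe {h : ℂ → ℂ} (hh : DiffContOnCl ℂ h (Metric.ball 0 1))
    (hh1 : ∀ z, ‖z‖ ≤ 1 → ‖h z‖ < 1) {z : ℂ} (hz : ‖z‖ < 1) :
    ∫ t : Circle, poissonKernel 0 z t * cayleyRe (h t) ∂m = cayleyRe (h z) := by
  have hne : ∀ w ∈ closure (Metric.ball (0 : ℂ) 1), 1 - h w ≠ 0 := by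
    intro w hw
    rw [closure_ball _ one_ne_zero, mem_closedBall_zero_iff] at hw
    exact one_sub_ne_zero_of_norm_lt (hh1 w hw)
  have hd : DiffContOnCl ℂ (fun w => (1 + h w) / (1 - h w)) (Metric.ball 0 1) := by
    simp_rw [div_eq_mul_inv]
    exact (diffContOnCl_const.add hh).smul ((diffContOnCl_const.sub hh).inv hne)
  have h1 := integral_poissonKernel_smul hd hz
  have hc : Continuous fun t : Circle => (1 + h t) / (1 - h t) := by
    have := hd.2
    rw [closure_ball _ one_ne_zero] at this
    exact this.comp_continuous (by fun_prop) (by simp [Circle.norm_coe])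
  have h2 := integral_re (integrable_of_continuous
    ((continuous_poissonKernel hz).smul hc) m)
  simp only [Pi.smul_apply', h1] at h2
  rw [← re_cayley, ← RCLike.re_eq_complex_re, ← h2]
  refine integral_congr_ae (.of_forall fun t => ?_)
  simp [← re_cayley]

/-- Fatou's lemma for a positive harmonic function with boundary values. -/
lemma integral_poissonKernel_mul_cayleyRe_le {h : ℂ → ℂ} (hh : DifferentiableOn ℂ h (Metric.ball 0 1))
    (hh1 : ∀ z, ‖z‖ < 1 → ‖h z‖ < 1) {H : Circle → ℂ}
    (hH : ∀ᵐ t : Circle ∂m, Tendsto (fun n => h (radius n * t)) atTop (𝓝 (H t)))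
    (hH1 : ∀ᵐ t : Circle ∂m, ‖H t‖ < 1) {z : ℂ} (hz : ‖z‖ < 1) :
    Integrable (fun t : Circle => poissonKernel 0 z t * cayleyRe (H t)) m ∧
      ∫ t : Circle, poissonKernel 0 z t * cayleyRe (H t) ∂m ≤ cayleyRe (h z) := by
  have hnorm : ∀ n w, ‖w‖ ≤ 1 → ‖h (radius n * w)‖ < 1 := fun n w hw =>
    hh1 _ (norm_radius_mul_lt hw n)
  have hcont : ∀ n, Continuous fun t : Circle =>
      poissonKernel 0 z t * cayleyRe (h (radius n * t)) := fun n =>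
    (continuous_poissonKernel hz).mul (continuous_iff_continuousAt.2 fun t =>
      ContinuousAt.comp (f := fun t : Circle => h (radius n * t))
        (continuousAt_cayleyRe (hnorm n t (Circle.norm_coe t).le))
        (continuous_dilation hh n).continuousAt)
  have hlim : ∀ᵐ t : Circle ∂m, Tendsto
      (fun n => poissonKernel 0 z t * cayleyRe (h (radius n * t))) atTop
      (𝓝 (poissonKernel 0 z t * cayleyRe (H t))) := by
    filter_upwards [hH, hH1] with t ht ht1
    exact ((continuousAt_cayleyRe ht1).tendsto.comp ht).const_mul _
  have hnn : ∀ᵐ t : Circle ∂m, 0 ≤ poissonKernel 0 z t * cayleyRe (H t) := by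
    filter_upwards [hH1] with t ht1
    exact mul_nonneg (poissonKernel_nonneg t hz) (cayleyRe_pos ht1).le
  have hmeas : AEStronglyMeasurable (fun t : Circle => poissonKernel 0 z t * cayleyRe (H t)) m :=
    aestronglyMeasurable_of_tendsto_ae atTop (fun n => (hcont n).aestronglyMeasurable) hlim
  have hval : ∀ n, ∫⁻ t : Circle, ENNReal.ofReal
      (poissonKernel 0 z t * cayleyRe (h (radius n * t))) ∂m =
      ENNReal.ofReal (cayleyRe (h (radius n * z))) := by
    intro n
    rw [← ofReal_integral_eq_lintegral_ofReal (integrable_of_continuous (hcont n) m)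
      (.of_forall fun t => mul_nonneg (poissonKernel_nonneg t hz)
        (cayleyRe_pos (hnorm n t (Circle.norm_coe t).le)).le)]
    rw [integral_poissonKernel_mul_cayleyRe (diffContOnCl_comp_mul hh n) (hnorm n) hz]
  have hle : ∫⁻ t : Circle, ENNReal.ofReal (poissonKernel 0 z t * cayleyRe (H t)) ∂m ≤
      ENNReal.ofReal (cayleyRe (h z)) := by
    calc _ = ∫⁻ t : Circle, liminf (fun n => ENNReal.ofReal
          (poissonKernel 0 z t * cayleyRe (h (radius n * t)))) atTop ∂m := by
          refine lintegral_congr_ae ?_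
          filter_upwards [hlim] with t ht
          exact ((ENNReal.continuous_ofReal.tendsto _).comp ht).liminf_eq.symm
      _ ≤ liminf (fun n => ∫⁻ t : Circle, ENNReal.ofReal
          (poissonKernel 0 z t * cayleyRe (h (radius n * t))) ∂m) atTop :=
          lintegral_liminf_le fun n => (hcont n).measurable.ennreal_ofReal
      _ = ENNReal.ofReal (cayleyRe (h z)) := by
          simp_rw [hval]
          refine Tendsto.liminf_eq ?_
          exact (ENNReal.continuous_ofReal.tendsto _).comp
            ((continuousAt_cayleyRe (hh1 z hz)).tendsto.comp (tendsto_dilation hh hz))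
  refine ⟨⟨hmeas, ?_⟩, ?_⟩
  · rw [hasFiniteIntegral_iff_ofReal hnn]
    exact hle.trans_lt ENNReal.ofReal_lt_top
  · rw [integral_eq_lintegral_of_nonneg_ae hnn hmeas]
    exact ENNReal.toReal_le_of_le_ofReal (cayleyRe_pos (hh1 z hz)).le hle

/-! ### The Herglotz measure of a Schur function -/

lemma IsHerglotzMeasure.integral_poissonKernel {f : ℂ → ℂ} {μ : Measure Circle}
    [IsFiniteMeasure μ] (hμ : IsHerglotzMeasure f μ) {z : ℂ} (hz : ‖z‖ < 1) :
    ∫ t : Circle, poissonKernel 0 z t ∂μ = cayleyRe (z * f z) := by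
  have hc : Continuous fun t : Circle => ((t : ℂ) + z) / ((t : ℂ) - z) :=
    Continuous.div (by fun_prop) (by fun_prop) fun t => circle_sub_ne_zero t hz
  have h := integral_re (integrable_of_continuous hc μ)
  rw [← hμ z (by simpa using hz)] at h
  rw [← re_cayley, ← RCLike.re_eq_complex_re, ← h]
  refine integral_congr_ae (.of_forall fun t => ?_)
  simp only [RCLike.re_eq_complex_re, poissonKernel_re_eq]

/-- The Poisson integral of `μ` has radial limit `μ'` by Fatou's theorem; its closed form `cayleyRe
(z f(z))` has a radial limit by continuity, because the trace of `f` has modulus less than one. -/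
lemma IsHerglotzMeasure.ae_density_eq {f : ℂ → ℂ} (hf : IsSchur f) {μ : Measure Circle}
    [IsFiniteMeasure μ] (hμ : IsHerglotzMeasure f μ)
    (hf1 : ∀ᵐ t : Circle ∂m, ‖trace f t‖ < 1) :
    ∀ᵐ t : Circle ∂m, density μ t = cayleyRe (t * trace f t) := by
  filter_upwards [ae_tendsto_integral_poissonKernel_density μ, hf.ae_tendsto_dilation, hf1]
    with t h1 h2 h3
  have h4 := (h1 1).comp (tendsto_radius_stolz t)
  have h5 : ‖(t : ℂ) * trace f t‖ < 1 := by rwa [norm_mul, Circle.norm_coe, one_mul]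
  have h6 := (continuousAt_cayleyRe h5).tendsto.comp ((tendsto_radius_mul t).mul h2)
  refine tendsto_nhds_unique h4 (h6.congr fun n => ?_)
  exact (hμ.integral_poissonKernel (norm_radius_mul_lt (Circle.norm_coe t).le n)).symm

/-! ### Blaschke factors -/

/-- The elementary Blaschke factor vanishing at `a`. -/
def blaschke (a z : ℂ) : ℂ := (z - a) / (1 - (starRingEnd ℂ) a * z)

lemma one_sub_conj_mul_ne_zero {a z : ℂ} (ha : ‖a‖ < 1) (hz : ‖z‖ ≤ 1) :
    1 - (starRingEnd ℂ) a * z ≠ 0 := by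
  refine one_sub_ne_zero_of_norm_lt ?_
  rw [norm_mul, RCLike.norm_conj]
  nlinarith [norm_nonneg a, norm_nonneg z]

lemma one_add_conj_mul_ne_zero {a z : ℂ} (ha : ‖a‖ < 1) (hz : ‖z‖ ≤ 1) :
    1 + (starRingEnd ℂ) a * z ≠ 0 := by
  have := one_sub_conj_mul_ne_zero (z := -z) ha (by rwa [norm_neg])
  simpa using this

lemma norm_sq_one_sub_conj_mul (a z : ℂ) :
    ‖1 - (starRingEnd ℂ) a * z‖ ^ 2 = ‖z - a‖ ^ 2 + (1 - ‖a‖ ^ 2) * (1 - ‖z‖ ^ 2) := by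
  simp only [Complex.sq_norm, Complex.normSq_apply, Complex.sub_re, Complex.sub_im,
    Complex.mul_re, Complex.mul_im, Complex.conj_re, Complex.conj_im, Complex.one_re,
    Complex.one_im]
  ring

lemma one_sub_norm_sq_blaschke {a z : ℂ} (ha : ‖a‖ < 1) (hz : ‖z‖ ≤ 1) :
    1 - ‖blaschke a z‖ ^ 2 =
      (1 - ‖a‖ ^ 2) * (1 - ‖z‖ ^ 2) / ‖1 - (starRingEnd ℂ) a * z‖ ^ 2 := by
  have h : ‖1 - (starRingEnd ℂ) a * z‖ ≠ 0 :=
    norm_ne_zero_iff.2 (one_sub_conj_mul_ne_zero ha hz)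
  rw [blaschke, norm_div, div_pow, eq_div_iff (pow_ne_zero 2 h), sub_mul,
    div_mul_cancel₀ _ (pow_ne_zero 2 h), norm_sq_one_sub_conj_mul]
  ring

lemma norm_blaschke_le_one {a z : ℂ} (ha : ‖a‖ < 1) (hz : ‖z‖ ≤ 1) : ‖blaschke a z‖ ≤ 1 := by
  have h := one_sub_norm_sq_blaschke ha hz
  have h2 : 0 ≤ 1 - ‖blaschke a z‖ ^ 2 := by
    rw [h]
    have := pow_le_one₀ (n := 2) (norm_nonneg _) ha.le
    have := pow_le_one₀ (n := 2) (norm_nonneg _) hz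
    exact div_nonneg (mul_nonneg (by linarith) (by linarith)) (by positivity)
  nlinarith [norm_nonneg (blaschke a z)]

lemma norm_blaschke_lt_one {a z : ℂ} (ha : ‖a‖ < 1) (hz : ‖z‖ < 1) : ‖blaschke a z‖ < 1 := by
  have h := one_sub_norm_sq_blaschke ha hz.le
  have h2 : 0 < 1 - ‖blaschke a z‖ ^ 2 := by
    rw [h]
    have := pow_lt_one₀ (norm_nonneg _) ha two_ne_zero
    have := pow_lt_one₀ (norm_nonneg _) hz two_ne_zero
    exact div_pos (mul_pos (by linarith) (by linarith))
      (pow_pos (norm_pos_iff.2 (one_sub_conj_mul_ne_zero ha hz.le)) 2)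
  nlinarith [norm_nonneg (blaschke a z)]

lemma norm_blaschke_circle {a : ℂ} (ha : ‖a‖ < 1) (t : Circle) : ‖blaschke a t‖ = 1 := by
  have h := one_sub_norm_sq_blaschke ha (Circle.norm_coe t).le
  rw [Circle.norm_coe, one_pow, sub_self, mul_zero, zero_div, sub_eq_zero] at h
  exact (pow_eq_one_iff_of_nonneg (norm_nonneg _) two_ne_zero).1 h.symm

@[simp] lemma blaschke_self (a : ℂ) : blaschke a a = 0 := by simp [blaschke]

lemma diffContOnCl_blaschke {a : ℂ} (ha : ‖a‖ < 1) :
    DiffContOnCl ℂ (blaschke a) (Metric.ball 0 1) := by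
  refine DifferentiableOn.diffContOnCl ?_
  rw [closure_ball _ one_ne_zero]
  unfold blaschke
  refine DifferentiableOn.div (by fun_prop) (by fun_prop) fun z hz => ?_
  exact one_sub_conj_mul_ne_zero ha (by simpa using hz)

lemma differentiableOn_blaschke {a : ℂ} (ha : ‖a‖ < 1) :
    DifferentiableOn ℂ (blaschke a) (Metric.ball 0 1) := (diffContOnCl_blaschke ha).1

/-- Dividing a bounded holomorphic function by a Blaschke factor does not increase its bound. -/
lemma norm_le_of_blaschke_mul {g : ℂ → ℂ} (hg : DifferentiableOn ℂ g (Metric.ball 0 1)) {a : ℂ}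
    (ha : ‖a‖ < 1) {M : ℝ} (h : ∀ z, ‖z‖ < 1 → ‖blaschke a z * g z‖ ≤ M) {z : ℂ}
    (hz : ‖z‖ < 1) : ‖g z‖ ≤ M := by
  have hM : 0 ≤ M := (norm_nonneg _).trans (h 0 (by simp))
  have ha' : 0 < 1 - ‖a‖ := by linarith
  -- On `|w| = r` the Blaschke factor satisfies `|b|² ≥ 1 - K (1 - r²)`, which tends to `1` as `r →
  -- 1`. The maximum principle on the disk of radius `r`, followed by `r → 1`, gives the bound
  -- without boundary values of `g`.
  set K := (1 - ‖a‖ ^ 2) / (1 - ‖a‖) ^ 2 with hK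
  have hpt : ∀ w : ℂ, ‖w‖ < 1 → ‖g w‖ ^ 2 * (1 - K * (1 - ‖w‖ ^ 2)) ≤ M ^ 2 := by
    intro w hw
    have h1 : 1 - K * (1 - ‖w‖ ^ 2) ≤ ‖blaschke a w‖ ^ 2 := by
      have h2 : 1 - ‖blaschke a w‖ ^ 2 ≤ K * (1 - ‖w‖ ^ 2) := by
        rw [one_sub_norm_sq_blaschke ha hw.le, hK, div_mul_eq_mul_div]
        have := pow_le_one₀ (n := 2) (norm_nonneg _) ha.le
        have := pow_le_one₀ (n := 2) (norm_nonneg _) hw.le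
        have h3 := norm_sub_norm_le 1 ((starRingEnd ℂ) a * w)
        rw [norm_mul, RCLike.norm_conj, norm_one] at h3
        have h4 : 1 - ‖a‖ ≤ ‖1 - (starRingEnd ℂ) a * w‖ := by
          nlinarith [norm_nonneg a, norm_nonneg w]
        have h5 : 0 ≤ (1 - ‖a‖ ^ 2) * (1 - ‖w‖ ^ 2) :=
          mul_nonneg (by linarith) (by linarith)
        gcongr
      linarith
    calc _ ≤ ‖g w‖ ^ 2 * ‖blaschke a w‖ ^ 2 := by gcongr
      _ = ‖blaschke a w * g w‖ ^ 2 := by rw [norm_mul]; ring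
      _ ≤ _ := by gcongr; exact h w hw
  have hr : ∀ r : ℝ, ‖z‖ < r → r < 1 → 0 < 1 - K * (1 - r ^ 2) →
      ‖g z‖ ^ 2 * (1 - K * (1 - r ^ 2)) ≤ M ^ 2 := by
    intro r h1 h2 h3
    have hr0 : r ≠ 0 := ((norm_nonneg z).trans_lt h1).ne'
    have hd : DiffContOnCl ℂ g (Metric.ball 0 r) := by
      refine DifferentiableOn.diffContOnCl ?_
      rw [closure_ball _ hr0]
      exact hg.mono (Metric.closedBall_subset_ball h2)
    have h4 : ‖g z‖ ≤ √(M ^ 2 / (1 - K * (1 - r ^ 2))) := by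
      refine Complex.norm_le_of_forall_mem_frontier_norm_le Metric.isBounded_ball hd
        (fun w hw => ?_) (subset_closure (by simpa using h1))
      rw [frontier_ball _ hr0, mem_sphere_zero_iff_norm] at hw
      refine Real.le_sqrt_of_sq_le ?_
      rw [le_div_iff₀ h3, ← hw]
      exact hpt w (by rwa [hw])
    rw [← le_div_iff₀ h3]
    calc _ ≤ √(M ^ 2 / (1 - K * (1 - r ^ 2))) ^ 2 := by gcongr
      _ = _ := Real.sq_sqrt (by positivity)
  have hlim : Tendsto (fun r : ℝ => ‖g z‖ ^ 2 * (1 - K * (1 - r ^ 2))) (𝓝[<] 1)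
      (𝓝 (‖g z‖ ^ 2)) := by
    have hc : Continuous fun r : ℝ => ‖g z‖ ^ 2 * (1 - K * (1 - r ^ 2)) := by fun_prop
    have := hc.tendsto 1
    simp only [one_pow, sub_self, mul_zero, sub_zero, mul_one] at this
    exact this.mono_left nhdsWithin_le_nhds
  have hpos : ∀ᶠ r : ℝ in 𝓝[<] 1, 0 < 1 - K * (1 - r ^ 2) := by
    have hc : Continuous fun r : ℝ => 1 - K * (1 - r ^ 2) := by fun_prop
    have := hc.tendsto 1
    simp only [one_pow, sub_self, mul_zero, sub_zero] at this
    exact (this.mono_left nhdsWithin_le_nhds).eventually (Ioi_mem_nhds one_pos)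
  have hfin : ‖g z‖ ^ 2 ≤ M ^ 2 := by
    refine le_of_tendsto hlim ?_
    filter_upwards [hpos, Ioo_mem_nhdsLT hz] with r h1 h2 using hr r h2.1 h2.2 h1
  exact abs_le_of_sq_le_sq' hfin hM |>.2

lemma _root_.DiffContOnCl.blaschke_comp {b : ℂ → ℂ} (hb : DiffContOnCl ℂ b (Metric.ball 0 1))
    {c : ℂ} (hc : ‖c‖ < 1) (hb1 : ∀ z, ‖z‖ ≤ 1 → ‖b z‖ ≤ 1) :
    DiffContOnCl ℂ (fun z => blaschke c (b z)) (Metric.ball 0 1) := by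
  have hnum : DiffContOnCl ℂ (fun z => b z - c) (Metric.ball 0 1) := hb.sub_const c
  have hmul : DiffContOnCl ℂ (fun z => (starRingEnd ℂ) c * b z) (Metric.ball 0 1) :=
    hb.const_smul ((starRingEnd ℂ) c)
  have hden : DiffContOnCl ℂ (fun z => 1 - (starRingEnd ℂ) c * b z) (Metric.ball 0 1) :=
    diffContOnCl_const.sub hmul
  have hinv := hden.inv fun z hz => by
    rw [closure_ball _ one_ne_zero, mem_closedBall_zero_iff] at hz
    exact one_sub_conj_mul_ne_zero hc (hb1 z hz)
  simp only [blaschke, div_eq_mul_inv]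
  exact hnum.smul hinv

/-- Since `|1 - conj a z| ≤ 2`, one has `1 - |b|² ≥ (1 - |a|)(1 - |z|²) / 4`; then `|b| ≤ 1 - (1 -
|b|²) / 2` and `1 - u ≤ exp (-u)`. The exponential form turns a divergent sum of `1 - |a_k|` into a
product tending to zero. -/
lemma norm_blaschke_le {a z : ℂ} (ha : ‖a‖ < 1) (hz : ‖z‖ < 1) :
    ‖blaschke a z‖ ≤ Real.exp (-((1 - ‖z‖ ^ 2) / 8 * (1 - ‖a‖))) := by
  have h1 := one_sub_norm_sq_blaschke ha hz.le
  have hz2 := pow_lt_one₀ (norm_nonneg _) hz two_ne_zero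
  have h2 : (1 - ‖a‖) * (1 - ‖z‖ ^ 2) / 4 ≤ 1 - ‖blaschke a z‖ ^ 2 := by
    rw [h1]
    have h3 : ‖1 - (starRingEnd ℂ) a * z‖ ≤ 2 := by
      have := norm_sub_le 1 ((starRingEnd ℂ) a * z)
      rw [norm_mul, RCLike.norm_conj, norm_one] at this
      nlinarith [norm_nonneg a, norm_nonneg z]
    have h4 : 0 < ‖1 - (starRingEnd ℂ) a * z‖ :=
      norm_pos_iff.2 (one_sub_conj_mul_ne_zero ha hz.le)
    have h5 : 1 - ‖a‖ ≤ 1 - ‖a‖ ^ 2 := by nlinarith [norm_nonneg a]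
    have h6 : ‖1 - (starRingEnd ℂ) a * z‖ ^ 2 ≤ 4 := by nlinarith
    have h7 : 0 < 1 - ‖a‖ := by linarith
    exact div_le_div₀ (mul_nonneg (by linarith) (by linarith))
      (mul_le_mul_of_nonneg_right h5 (by linarith)) (by positivity) h6
  have h3 := Real.add_one_le_exp (-((1 - ‖z‖ ^ 2) / 8 * (1 - ‖a‖)))
  nlinarith [norm_nonneg (blaschke a z), sq_nonneg (1 - ‖blaschke a z‖)]

lemma tendsto_prod_blaschke {a : ℕ → ℂ} (ha : ∀ k, ‖a k‖ < 1)
    (hsum : ¬ Summable fun k => 1 - ‖a k‖) {z : ℂ} (hz : ‖z‖ < 1) :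
    Tendsto (fun n => ∏ j ∈ Finset.range n, ‖blaschke (a j) z‖) atTop (𝓝 0) := by
  have hz2 := pow_lt_one₀ (norm_nonneg _) hz two_ne_zero
  have h1 := (not_summable_iff_tendsto_nat_atTop_of_nonneg
    (fun k => by linarith [ha k])).1 hsum
  have h2 : Tendsto (fun n => Real.exp (-((1 - ‖z‖ ^ 2) / 8 *
      ∑ j ∈ Finset.range n, (1 - ‖a j‖)))) atTop (𝓝 0) :=
    Real.tendsto_exp_neg_atTop_nhds_zero.comp (h1.const_mul_atTop (by linarith))
  refine squeeze_zero (fun n => Finset.prod_nonneg fun _ _ => norm_nonneg _) (fun n => ?_) h2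
  rw [Finset.mul_sum, ← Finset.sum_neg_distrib, Real.exp_sum]
  exact Finset.prod_le_prod (fun _ _ => norm_nonneg _) fun j _ => norm_blaschke_le (ha j) hz

/-! ### One step of the Schur algorithm -/

/-- The inverse of the Schur step: `w ↦ (ζ w + γ) / (1 + conj γ * ζ w)`, for a given value `ζ` of
the Blaschke factor. -/
def moebius (ζ γ w : ℂ) : ℂ := (ζ * w + γ) / (1 + (starRingEnd ℂ) γ * (ζ * w))

lemma moebius_eq_blaschke (ζ γ w : ℂ) : moebius ζ γ w = blaschke (-γ) (ζ * w) := by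
  simp [moebius, blaschke]

lemma norm_moebius_lt_one {ζ γ w : ℂ} (hγ : ‖γ‖ < 1) (hζ : ‖ζ‖ ≤ 1) (hw : ‖w‖ < 1) :
    ‖moebius ζ γ w‖ < 1 := by
  rw [moebius_eq_blaschke]
  refine norm_blaschke_lt_one (by rwa [norm_neg]) ?_
  rw [norm_mul]
  nlinarith [norm_nonneg ζ, norm_nonneg w]

/-- Each backward step extracts one factor `ζ` from a difference; iterated, this places a Blaschke
product in the interpolation error. -/
lemma moebius_sub_moebius {ζ γ w v : ℂ} (h1 : 1 + (starRingEnd ℂ) γ * (ζ * w) ≠ 0)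
    (h2 : 1 + (starRingEnd ℂ) γ * (ζ * v) ≠ 0) :
    moebius ζ γ w - moebius ζ γ v = ζ * ((w - v) * ((1 - (starRingEnd ℂ) γ * γ) /
      ((1 + (starRingEnd ℂ) γ * (ζ * w)) * (1 + (starRingEnd ℂ) γ * (ζ * v))))) := by
  rw [moebius, moebius, div_sub_div _ _ h1 h2, mul_div_assoc', mul_div_assoc']
  congr 1
  ring

/-- The relation between values of consecutive Schur remainders, in terms of the real part of the
Cayley transform. -/
lemma cayleyRe_mul_moebius {b ζ γ w : ℂ} (hγ : ‖γ‖ < 1) (hζ : ‖ζ‖ = 1) (hb : ‖b‖ = 1)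
    (hw : ‖w‖ < 1) :
    cayleyRe (b * moebius ζ γ w) =
      cayleyRe (b * γ) * cayleyRe (ζ * blaschke ((starRingEnd ℂ) γ) b * w) := by
  have hζw : ‖ζ * w‖ < 1 := by rwa [norm_mul, hζ, one_mul]
  have hγ' : ‖(starRingEnd ℂ) γ‖ < 1 := by rwa [RCLike.norm_conj]
  have hb' : ‖blaschke ((starRingEnd ℂ) γ) b‖ = 1 :=
    norm_blaschke_circle hγ' ⟨b, mem_sphere_zero_iff_norm.2 hb⟩
  have h1 : 1 + (starRingEnd ℂ) γ * (ζ * w) ≠ 0 := one_add_conj_mul_ne_zero hγ hζw.le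
  have h2 : 1 - γ * b ≠ 0 := by
    simpa using one_sub_conj_mul_ne_zero hγ' hb.le
  have h3 := one_sub_norm_sq_blaschke (a := -γ) (by rwa [norm_neg]) hζw.le
  rw [← moebius_eq_blaschke, norm_neg, map_neg, neg_mul, sub_neg_eq_add, norm_mul ζ, hζ,
    one_mul] at h3
  -- This factorization moves the Möbius map from `w` to `b`: the denominator of the Cayley
  -- transform splits into the one for `b γ` and the one for the new unimodular factor times `w`.
  have h4 : 1 - b * moebius ζ γ w = (1 - γ * b) *
      (1 - ζ * blaschke ((starRingEnd ℂ) γ) b * w) / (1 + (starRingEnd ℂ) γ * (ζ * w)) := by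
    have hq : (1 - γ * b) * ((b - (starRingEnd ℂ) γ) / (1 - γ * b)) = b - (starRingEnd ℂ) γ :=
      mul_div_cancel₀ _ h2
    rw [moebius, blaschke, Complex.conj_conj, eq_div_iff h1, sub_mul, mul_assoc b,
      div_mul_cancel₀ _ h1]
    linear_combination (ζ * w) * hq
  have h5 : ‖1 + (starRingEnd ℂ) γ * (ζ * w)‖ ≠ 0 := norm_ne_zero_iff.2 h1
  rw [cayleyRe, cayleyRe, cayleyRe, h4, norm_mul b, hb, one_mul, h3, norm_mul (ζ * _), norm_mul ζ,
    hζ, hb', norm_mul b, hb, norm_div, norm_mul, mul_comm b γ]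
  simp only [one_mul]
  generalize ‖1 + (starRingEnd ℂ) γ * (ζ * w)‖ = D at h5
  field_simp

/-- Schur functions that are strictly contractive in the disk and almost everywhere on the
circle. -/
structure IsStrictSchur (g : ℂ → ℂ) : Prop where
  differentiableOn : DifferentiableOn ℂ g (Metric.ball 0 1)
  norm_lt_one : ∀ z, ‖z‖ < 1 → ‖g z‖ < 1
  norm_trace_lt_one : ∀ᵐ t : Circle ∂m, ‖trace g t‖ < 1

lemma IsStrictSchur.isSchur {g : ℂ → ℂ} (hg : IsStrictSchur g) : IsSchur g :=
  ⟨hg.differentiableOn, fun z hz => (hg.norm_lt_one z (by simpa using hz)).le⟩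

/-- If `|g| = 1` somewhere in the disk, the maximum principle makes `g` constant, and its radial
limits then have modulus one, contrary to the boundary hypothesis. -/
lemma IsSchur.isStrictSchur {g : ℂ → ℂ} (hg : IsSchur g)
    (h : ∀ᵐ t : Circle ∂m, ‖trace g t‖ < 1) : IsStrictSchur g := by
  refine ⟨hg.1, fun z hz => lt_of_le_of_ne (hg.2 z (by simpa using hz)) fun h1 => ?_, h⟩
  have hconst := Complex.eqOn_of_isPreconnected_of_isMaxOn_norm
    (convex_ball (0 : ℂ) 1).isPreconnected Metric.isOpen_ball hg.1 (c := z)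
    (by simpa using hz) (fun w hw => by
      simp only [mem_ofPred_eq, Function.comp_apply]
      rw [h1]
      exact hg.2 w hw)
  obtain ⟨t, ht1, ht2⟩ := (h.and hg.ae_tendsto_dilation).exists
  have h2 : Tendsto (fun n => g (radius n * t)) atTop (𝓝 (g z)) := by
    refine tendsto_const_nhds.congr fun n => (hconst ?_).symm
    simpa using norm_radius_mul_lt (Circle.norm_coe t).le n
  rw [tendsto_nhds_unique ht2 h2, h1] at ht1
  exact lt_irrefl _ ht1

lemma blaschke_mul_schurStep {g : ℂ → ℂ} {a z : ℂ} (ha : ‖a‖ < 1) (hz : ‖z‖ < 1) :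
    blaschke a z * schurStep a g z = blaschke (g a) (g z) := by
  have h := sub_smul_dslope (fun w => (g w - g a) / (1 - (starRingEnd ℂ) (g a) * g w)) a z
  simp only [sub_self, zero_div, sub_zero, smul_eq_mul] at h
  have h1 := one_sub_conj_mul_ne_zero ha hz.le
  rw [schurStep, blaschke, blaschke, ← h, ← mul_assoc, div_mul_cancel₀ _ h1]

lemma moebius_of_mul_eq_blaschke {ζ γ w v : ℂ} (hγ : ‖γ‖ < 1) (hv : ‖v‖ < 1)
    (h : ζ * w = blaschke γ v) : v = moebius ζ γ w := by
  have h1 := one_sub_conj_mul_ne_zero hγ hv.le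
  have h3 : 1 - (starRingEnd ℂ) γ * γ ≠ 0 := one_sub_conj_mul_ne_zero hγ hγ.le
  have h4 : 1 + (starRingEnd ℂ) γ * ((v - γ) / (1 - (starRingEnd ℂ) γ * v)) =
      (1 - (starRingEnd ℂ) γ * γ) / (1 - (starRingEnd ℂ) γ * v) := by
    rw [mul_div_assoc', eq_div_iff h1, add_mul, div_mul_cancel₀ _ h1]
    ring
  rw [moebius, h, blaschke, h4, eq_div_iff (div_ne_zero h3 h1), div_add' _ _ _ h1, mul_div_assoc']
  congr 1
  ring

/-- The Schur identity divides a bounded function by a Blaschke factor, which preserves the bound.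
Taking radial limits gives it on the circle, where the Blaschke factor is unimodular and strict
contractivity is inherited. -/
lemma IsStrictSchur.schurStep {g : ℂ → ℂ} (hg : IsStrictSchur g) {a : ℂ} (ha : ‖a‖ < 1) :
    IsStrictSchur (schurStep a g) ∧ ∀ᵐ t : Circle ∂m,
      trace g t = moebius (blaschke a t) (g a) (trace (schurStep a g) t) := by
  have hga := hg.norm_lt_one a ha
  have hd : DifferentiableOn ℂ (MultipointSchur.schurStep a g) (Metric.ball 0 1) := by
    unfold MultipointSchur.schurStep
    refine DifferentiableOn.mul (by fun_prop) ?_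
    refine (Complex.differentiableOn_dslope
      (Metric.isOpen_ball.mem_nhds (by simpa using ha))).2 ?_
    refine (hg.differentiableOn.sub_const _).div
      (((hg.differentiableOn.const_mul _).const_sub _)) fun z hz => ?_
    exact one_sub_conj_mul_ne_zero hga (hg.norm_lt_one z (by simpa using hz)).le
  have hs : IsSchur (MultipointSchur.schurStep a g) := by
    refine ⟨hd, fun z hz => norm_le_of_blaschke_mul hd ha (M := 1) (fun w hw => ?_)
      (by simpa using hz)⟩
    rw [blaschke_mul_schurStep ha hw]
    exact norm_blaschke_le_one hga (hg.norm_lt_one w hw).le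
  have htr : ∀ᵐ t : Circle ∂m, blaschke a t * trace (MultipointSchur.schurStep a g) t =
      blaschke (g a) (trace g t) := by
    filter_upwards [hs.ae_tendsto_dilation, hg.isSchur.ae_tendsto_dilation,
      hg.norm_trace_lt_one] with t h1 h2 h3
    have h4 : Tendsto (fun n => blaschke a (radius n * t)) atTop (𝓝 (blaschke a t)) := by
      have hc : ContinuousAt (blaschke a) t := by
        unfold blaschke
        exact ContinuousAt.div (by fun_prop) (by fun_prop)
          (one_sub_conj_mul_ne_zero ha (Circle.norm_coe t).le)
      exact hc.tendsto.comp (tendsto_radius_mul t)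
    have h5 : ContinuousAt (blaschke (g a)) (trace g t) := by
      unfold blaschke
      exact ContinuousAt.div (by fun_prop) (by fun_prop) (one_sub_conj_mul_ne_zero hga h3.le)
    refine tendsto_nhds_unique (h4.mul h1) ((h5.tendsto.comp h2).congr fun n => ?_)
    exact (blaschke_mul_schurStep ha (norm_radius_mul_lt (Circle.norm_coe t).le n)).symm
  refine ⟨hs.isStrictSchur ?_, ?_⟩
  · filter_upwards [htr, hg.norm_trace_lt_one] with t h1 h2
    have h3 := congrArg norm h1
    rw [norm_mul, norm_blaschke_circle ha, one_mul] at h3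
    rw [h3]
    exact norm_blaschke_lt_one hga h2
  · filter_upwards [htr, hg.norm_trace_lt_one] with t h1 h2
    exact moebius_of_mul_eq_blaschke hga h2 h1

/-! ### Rational interpolants -/

/-- The rational Schur function obtained from `n` backward Schur steps starting from `0`, for
nodes `a` and parameters `γ`, beginning at index `k`. -/
def interpolant (a γ : ℕ → ℂ) : ℕ → ℕ → ℂ → ℂ
  | 0, _ => fun _ => 0
  | n + 1, k => fun z => moebius (blaschke (a k) z) (γ k) (interpolant a γ n (k + 1) z)

/-- The finite Blaschke products through which the Schur remainders enter the density of the
Herglotz measure. -/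
def cofactor (a γ : ℕ → ℂ) : ℕ → ℂ → ℂ
  | 0 => fun z => z
  | k + 1 => fun z => blaschke (a k) z * blaschke ((starRingEnd ℂ) (γ k)) (cofactor a γ k z)

section

variable {a γ : ℕ → ℂ}

lemma norm_interpolant_lt_one (ha : ∀ k, ‖a k‖ < 1) (hγ : ∀ k, ‖γ k‖ < 1) (n k : ℕ) {z : ℂ}
    (hz : ‖z‖ ≤ 1) : ‖interpolant a γ n k z‖ < 1 := by
  induction n generalizing k with
  | zero => simp [interpolant]
  | succ n ih => exact norm_moebius_lt_one (hγ k) (norm_blaschke_le_one (ha k) hz) (ih (k + 1))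

lemma diffContOnCl_interpolant (ha : ∀ k, ‖a k‖ < 1) (hγ : ∀ k, ‖γ k‖ < 1) (n k : ℕ) :
    DiffContOnCl ℂ (interpolant a γ n k) (Metric.ball 0 1) := by
  induction n generalizing k with
  | zero => exact diffContOnCl_const
  | succ n ih =>
    simp only [interpolant, moebius_eq_blaschke]
    refine ((diffContOnCl_blaschke (ha k)).smul (ih (k + 1))).blaschke_comp
      (by rw [norm_neg]; exact hγ k) fun z hz => ?_
    rw [smul_eq_mul, norm_mul]
    exact mul_le_one₀ (norm_blaschke_le_one (ha k) hz) (norm_nonneg _)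
      (norm_interpolant_lt_one ha hγ n (k + 1) hz).le

lemma norm_cofactor_le_one (ha : ∀ k, ‖a k‖ < 1) (hγ : ∀ k, ‖γ k‖ < 1) (k : ℕ) {z : ℂ}
    (hz : ‖z‖ ≤ 1) : ‖cofactor a γ k z‖ ≤ 1 := by
  induction k with
  | zero => exact hz
  | succ k ih =>
    rw [cofactor, norm_mul]
    exact mul_le_one₀ (norm_blaschke_le_one (ha k) hz) (norm_nonneg _)
      (norm_blaschke_le_one (by rw [RCLike.norm_conj]; exact hγ k) ih)

lemma norm_cofactor_circle (ha : ∀ k, ‖a k‖ < 1) (hγ : ∀ k, ‖γ k‖ < 1) (k : ℕ) (t : Circle) :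
    ‖cofactor a γ k t‖ = 1 := by
  induction k with
  | zero => exact Circle.norm_coe t
  | succ k ih =>
    rw [cofactor, norm_mul, norm_blaschke_circle (ha k), one_mul]
    exact norm_blaschke_circle (by rw [RCLike.norm_conj]; exact hγ k)
      ⟨_, mem_sphere_zero_iff_norm.2 ih⟩

lemma diffContOnCl_cofactor (ha : ∀ k, ‖a k‖ < 1) (hγ : ∀ k, ‖γ k‖ < 1) (k : ℕ) :
    DiffContOnCl ℂ (cofactor a γ k) (Metric.ball 0 1) := by
  induction k with
  | zero => exact differentiable_id.diffContOnCl
  | succ k ih =>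
    exact (diffContOnCl_blaschke (ha k)).smul
      (ih.blaschke_comp (by rw [RCLike.norm_conj]; exact hγ k)
        fun z hz => norm_cofactor_le_one ha hγ k hz)

lemma cayleyRe_interpolant (ha : ∀ k, ‖a k‖ < 1) (hγ : ∀ k, ‖γ k‖ < 1) (n k : ℕ) (t : Circle) :
    cayleyRe (cofactor a γ k t * interpolant a γ n k t) =
      ∏ j ∈ Finset.range n, cayleyRe (cofactor a γ (k + j) t * γ (k + j)) := by
  induction n generalizing k with
  | zero => simp [interpolant, cayleyRe]
  | succ n ih =>
    rw [interpolant, cayleyRe_mul_moebius (hγ k) (norm_blaschke_circle (ha k) t)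
      (norm_cofactor_circle ha hγ k t)
      (norm_interpolant_lt_one ha hγ n (k + 1) (Circle.norm_coe t).le),
      Finset.prod_range_succ', mul_comm]
    have := ih (k + 1)
    rw [cofactor] at this
    rw [this, add_zero]
    simp only [add_assoc, add_comm 1]

/-- Both products telescope by `cayleyRe_mul_moebius`. Ending at the remainder `0`, where the Cayley
real part is `1`, gives the density of the interpolant; ending at `w n` leaves one extra factor. -/
lemma cayleyRe_mul_eq (ha : ∀ k, ‖a k‖ < 1) (hγ : ∀ k, ‖γ k‖ < 1) (t : Circle) {w : ℕ → ℂ}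
    (hw : ∀ k, ‖w k‖ < 1)
    (hw' : ∀ k, w k = moebius (blaschke (a k) t) (γ k) (w (k + 1))) (n : ℕ) :
    cayleyRe (t * w 0) =
      cayleyRe (t * interpolant a γ n 0 t) * cayleyRe (cofactor a γ n t * w n) := by
  have h0 := cayleyRe_interpolant ha hγ n 0 t
  simp only [zero_add, show cofactor a γ 0 t = t from rfl] at h0
  rw [h0]
  clear h0
  induction n with
  | zero => simp [cofactor]
  | succ n ih =>
    rw [ih, hw' n, cayleyRe_mul_moebius (hγ n) (norm_blaschke_circle (ha n) t)
      (norm_cofactor_circle ha hγ n t) (hw (n + 1)), Finset.prod_range_succ]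
    simp only [cofactor, mul_assoc]

lemma exists_sub_interpolant_eq (ha : ∀ k, ‖a k‖ < 1) (hγ : ∀ k, ‖γ k‖ < 1) {F : ℕ → ℂ → ℂ}
    (hF : ∀ k, DifferentiableOn ℂ (F k) (Metric.ball 0 1))
    (hF1 : ∀ k z, ‖z‖ < 1 → ‖F k z‖ < 1)
    (hF' : ∀ k z, ‖z‖ < 1 → F k z = moebius (blaschke (a k) z) (γ k) (F (k + 1) z)) (n k : ℕ) :
    ∃ G : ℂ → ℂ, DifferentiableOn ℂ G (Metric.ball 0 1) ∧ ∀ z, ‖z‖ < 1 →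
      F k z - interpolant a γ n k z = (∏ j ∈ Finset.range n, blaschke (a (k + j)) z) * G z := by
  induction n generalizing k with
  | zero => exact ⟨F k, hF k, by simp [interpolant]⟩
  | succ n ih =>
    obtain ⟨G, hG, hG'⟩ := ih (k + 1)
    have hne : ∀ z w : ℂ, ‖z‖ < 1 → ‖w‖ < 1 →
        1 + (starRingEnd ℂ) (γ k) * (blaschke (a k) z * w) ≠ 0 := by
      intro z w hz hw
      refine one_add_conj_mul_ne_zero (hγ k) ?_
      rw [norm_mul]
      exact mul_le_one₀ (norm_blaschke_le_one (ha k) hz.le) (norm_nonneg _) hw.le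
    have hA := (diffContOnCl_interpolant ha hγ n (k + 1)).1
    have hA1 : ∀ z, ‖z‖ < 1 → ‖interpolant a γ n (k + 1) z‖ < 1 := fun z hz =>
      norm_interpolant_lt_one ha hγ n (k + 1) hz.le
    refine ⟨fun z => G z * ((1 - (starRingEnd ℂ) (γ k) * γ k) /
      ((1 + (starRingEnd ℂ) (γ k) * (blaschke (a k) z * F (k + 1) z)) *
        (1 + (starRingEnd ℂ) (γ k) * (blaschke (a k) z * interpolant a γ n (k + 1) z)))), ?_, ?_⟩
    · have hb := differentiableOn_blaschke (ha k)
      refine hG.mul (DifferentiableOn.div (differentiableOn_const _)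
        ((((hb.mul (hF (k + 1))).const_mul _).const_add _).mul
        (((hb.mul hA).const_mul _).const_add _)) fun z hz => ?_)
      rw [mem_ball_zero_iff] at hz
      exact mul_ne_zero (hne z _ hz (hF1 _ z hz)) (hne z _ hz (hA1 z hz))
    · intro z hz
      rw [hF' k z hz, interpolant, moebius_sub_moebius (hne z _ hz (hF1 _ z hz))
        (hne z _ hz (hA1 z hz)), hG' z hz, Finset.prod_range_succ']
      simp only [add_assoc, add_comm 1, add_zero]
      ring

lemma norm_le_of_prod_blaschke_mul (ha : ∀ k, ‖a k‖ < 1) {M : ℝ} (n : ℕ) {G : ℂ → ℂ}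
    (hG : DifferentiableOn ℂ G (Metric.ball 0 1))
    (h : ∀ z, ‖z‖ < 1 → ‖(∏ j ∈ Finset.range n, blaschke (a j) z) * G z‖ ≤ M) :
    ∀ z, ‖z‖ < 1 → ‖G z‖ ≤ M := by
  induction n generalizing G with
  | zero => simpa using h
  | succ n ih =>
    intro z hz
    refine norm_le_of_blaschke_mul hG (ha n) (fun w hw => ?_) hz
    refine ih ((differentiableOn_blaschke (ha n)).mul hG) (fun w hw => ?_) w hw
    have := h w hw
    rwa [Finset.prod_range_succ, mul_assoc] at this

/-- The error is bounded by `2`, as a difference of two contractions, and is divisible by the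
Blaschke product; dividing the factors out one at a time keeps the bound `2` for the quotient. -/
lemma norm_sub_interpolant_le (ha : ∀ k, ‖a k‖ < 1) (hγ : ∀ k, ‖γ k‖ < 1) {F : ℕ → ℂ → ℂ}
    (hF : ∀ k, DifferentiableOn ℂ (F k) (Metric.ball 0 1))
    (hF1 : ∀ k z, ‖z‖ < 1 → ‖F k z‖ < 1)
    (hF' : ∀ k z, ‖z‖ < 1 → F k z = moebius (blaschke (a k) z) (γ k) (F (k + 1) z)) (n : ℕ)
    {z : ℂ} (hz : ‖z‖ < 1) :
    ‖F 0 z - interpolant a γ n 0 z‖ ≤ 2 * ∏ j ∈ Finset.range n, ‖blaschke (a j) z‖ := by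
  obtain ⟨G, hG, hG'⟩ := exists_sub_interpolant_eq ha hγ hF hF1 hF' n 0
  simp only [zero_add] at hG'
  have h := norm_le_of_prod_blaschke_mul ha (M := 2) n hG fun w hw => by
    rw [← hG' w hw]
    have := norm_sub_le (F 0 w) (interpolant a γ n 0 w)
    have := hF1 0 w hw
    have := norm_interpolant_lt_one ha hγ n 0 hw.le
    linarith
  rw [hG' z hz, norm_mul, norm_prod, mul_comm]
  exact mul_le_mul_of_nonneg_right (h z hz) (Finset.prod_nonneg fun _ _ => norm_nonneg _)

end

/-! ### Weak convergence from convergence of Poisson integrals -/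

lemma norm_radial_lt {r : ℝ} (hr0 : 0 ≤ r) (hr1 : r < 1) (t : Circle) : ‖(r : ℂ) * t‖ < 1 := by
  rwa [norm_mul, Circle.norm_coe, mul_one, Complex.norm_real, Real.norm_of_nonneg hr0]

lemma poissonKernel_symm (r : ℝ) (s t : Circle) :
    poissonKernel 0 ((r : ℂ) * t) s = poissonKernel 0 ((r : ℂ) * s) t := by
  rw [poissonKernel_circle, poissonKernel_circle, norm_mul, norm_mul, Circle.norm_coe,
    Circle.norm_coe]
  congr 2
  have h : ((s : ℂ) - r * t) = s * t * (starRingEnd ℂ) ((t : ℂ) - r * s) := by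
    have hs : (s : ℂ) * (starRingEnd ℂ) (s : ℂ) = 1 := by
      rw [Complex.mul_conj, Circle.normSq_coe, Complex.ofReal_one]
    have ht : (t : ℂ) * (starRingEnd ℂ) (t : ℂ) = 1 := by
      rw [Complex.mul_conj, Circle.normSq_coe, Complex.ofReal_one]
    rw [map_sub, map_mul, Complex.conj_ofReal]
    linear_combination -(s : ℂ) * ht + r * t * hs
  rw [h, norm_mul, norm_mul, Circle.norm_coe, Circle.norm_coe, RCLike.norm_conj, one_mul, one_mul]

/-- Poisson integrals of a continuous function converge uniformly to it. -/
lemma exists_forall_abs_integral_poissonKernel_sub_le {s : Circle → ℝ} (hs : Continuous s)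
    {ε : ℝ} (hε : 0 < ε) :
    ∃ r : ℝ, 0 ≤ r ∧ r < 1 ∧ ∀ t : Circle,
      |∫ t' : Circle, poissonKernel 0 ((r : ℂ) * t) t' * s t' ∂m - s t| ≤ ε := by
  obtain ⟨M, hM⟩ : ∃ M, ∀ t, |s t| ≤ M := by
    obtain ⟨M, hM⟩ := isCompact_univ.exists_bound_of_continuousOn hs.continuousOn
    exact ⟨M, fun t => hM t (mem_univ t)⟩
  have hM0 : 0 ≤ M := (abs_nonneg _).trans (hM 1)
  obtain ⟨δ, hδ, huc⟩ := Metric.uniformContinuous_iff.1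
    (CompactSpace.uniformContinuous_of_continuous hs) (ε / 2) (by positivity)
  -- The first bound keeps `r ≥ 0`; the second gives `|t' - z| ≥ δ/2` when `t'` is at distance at
  -- least `δ` from `t`; the third makes the tail `2η / (δ/2)² · 2M` at most `ε/2`.
  set η := min (1 / 2) (min (δ / 2) (ε * δ ^ 2 / (32 * (M + 1)))) with hη
  have hη0 : 0 < η := by positivity
  have hη1 : η ≤ 1 / 2 := min_le_left _ _
  have hη2 : η ≤ δ / 2 := (min_le_right _ _).trans (min_le_left _ _)
  have hη3 : η ≤ ε * δ ^ 2 / (32 * (M + 1)) := (min_le_right _ _).trans (min_le_right _ _)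
  refine ⟨1 - η, by linarith, by linarith, fun t => ?_⟩
  set z : ℂ := ((1 - η : ℝ) : ℂ) * t with hzdef
  have hz : ‖z‖ < 1 := norm_radial_lt (by linarith) (by linarith) t
  have hzn : ‖z‖ = 1 - η := by
    rw [hzdef, norm_mul, Circle.norm_coe, mul_one, Complex.norm_real,
      Real.norm_of_nonneg (by linarith)]
  have hzt : ‖z - t‖ = η := by
    have : z - t = ((-η : ℝ) : ℂ) * t := by
      rw [hzdef]
      push_cast
      ring
    rw [this, norm_mul, Circle.norm_coe, mul_one, Complex.norm_real, Real.norm_eq_abs, abs_neg,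
      abs_of_pos hη0]
  have hsi : Integrable s m := integrable_of_continuous hs m
  have hsub : ∫ t' : Circle, poissonKernel 0 z t' * s t' ∂m - s t =
      ∫ t' : Circle, poissonKernel 0 z t' * (s t' - s t) ∂m := by
    simp_rw [mul_sub]
    rw [integral_sub (integrable_poissonKernel_mul hsi hz)
      (integrable_poissonKernel_mul (integrable_const _) hz), integral_mul_const,
      integral_poissonKernel hz, one_mul]
  rw [hsub]
  have hpt : ∀ t' : Circle, ‖poissonKernel 0 z t' * (s t' - s t)‖ ≤
      poissonKernel 0 z t' * (ε / 2) + ε / 2 := by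
    intro t'
    have hP := poissonKernel_nonneg t' hz
    rw [norm_mul, Real.norm_of_nonneg hP, Real.norm_eq_abs]
    rcases lt_or_ge (dist t' t) δ with h | h
    · have := huc h
      rw [Real.dist_eq] at this
      nlinarith
    · have h1 : δ / 2 ≤ ‖(t' : ℂ) - z‖ := by
        rw [circle_dist_eq] at h
        have := norm_sub_le_norm_sub_add_norm_sub (t' : ℂ) z t
        linarith
      have h2 : poissonKernel 0 z t' ≤ 2 * η / (δ / 2) ^ 2 := by
        refine (poissonKernel_le_div t' hz).trans ?_
        rw [hzn, sub_sub_cancel]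
        gcongr
      have h3 : |s t' - s t| ≤ 2 * M := by
        have := abs_sub (s t') (s t)
        have := hM t
        have := hM t'
        linarith
      have h4 : poissonKernel 0 z t' * |s t' - s t| ≤ 2 * η / (δ / 2) ^ 2 * (2 * M) := by gcongr
      have h5 : 2 * η / (δ / 2) ^ 2 * (2 * M) ≤ ε / 2 := by
        rw [le_div_iff₀ (by positivity)] at hη3
        rw [div_mul_eq_mul_div, div_le_iff₀ (by positivity)]
        nlinarith
      nlinarith
  calc |∫ t' : Circle, poissonKernel 0 z t' * (s t' - s t) ∂m|
      ≤ ∫ t' : Circle, ‖poissonKernel 0 z t' * (s t' - s t)‖ ∂m := by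
        rw [← Real.norm_eq_abs]
        exact norm_integral_le_integral_norm _
    _ ≤ ∫ t' : Circle, (poissonKernel 0 z t' * (ε / 2) + ε / 2) ∂m :=
        integral_mono (integrable_poissonKernel_mul (hsi.sub (integrable_const _)) hz).norm
          ((integrable_poissonKernel_mul (integrable_const _) hz).add (integrable_const _)) hpt
    _ = ε := by
        rw [integral_add (integrable_poissonKernel_mul (integrable_const _) hz)
          (integrable_const _), integral_mul_const, integral_poissonKernel hz]
        simp

lemma integral_integral_poissonKernel_swap {s : Circle → ℝ} (hs : Continuous s) {r : ℝ}
    (hr0 : 0 ≤ r) (hr1 : r < 1) (ν : Measure Circle) [IsFiniteMeasure ν] :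
    ∫ t : Circle, ∫ t' : Circle, poissonKernel 0 ((r : ℂ) * t) t' * s t' ∂m ∂ν =
      ∫ t' : Circle, s t' * ∫ t : Circle, poissonKernel 0 ((r : ℂ) * t') t ∂ν ∂m := by
  have hc : Continuous fun p : Circle × Circle =>
      poissonKernel 0 ((r : ℂ) * p.1) p.2 * s p.2 := by
    simp_rw [poissonKernel_circle]
    refine Continuous.mul (Continuous.div (by fun_prop) (by fun_prop) fun p => ?_) (by fun_prop)
    exact pow_ne_zero 2 (norm_ne_zero_iff.2
      (circle_sub_ne_zero p.2 (norm_radial_lt hr0 hr1 p.1)))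
  rw [integral_integral_swap (hc.integrable_of_hasCompactSupport
    (HasCompactSupport.of_compactSpace _))]
  refine integral_congr_ae (.of_forall fun t' => ?_)
  simp only
  rw [integral_mul_const, mul_comm]
  simp_rw [poissonKernel_symm r t']

/-- The function `s` is uniformly close to its Poisson extension `S` on a circle of radius `r < 1`.
By Fubini and the symmetry of the kernel, integrating `S` against `ν n` is integrating `s` against
the Poisson integral of `ν n` on that circle, where dominated convergence applies. -/
lemma tendsto_integral_of_tendsto_integral_poissonKernel {ν : ℕ → Measure Circle}
    [∀ n, IsProbabilityMeasure (ν n)] {μ : Measure Circle} [IsProbabilityMeasure μ]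
    (h : ∀ z : ℂ, ‖z‖ < 1 → Tendsto (fun n => ∫ t : Circle, poissonKernel 0 z t ∂(ν n)) atTop
      (𝓝 (∫ t : Circle, poissonKernel 0 z t ∂μ)))
    {s : Circle → ℝ} (hs : Continuous s) :
    Tendsto (fun n => ∫ t, s t ∂(ν n)) atTop (𝓝 (∫ t, s t ∂μ)) := by
  rw [Metric.tendsto_atTop']
  intro ε hε
  obtain ⟨r, hr0, hr1, hr⟩ := exists_forall_abs_integral_poissonKernel_sub_le hs
    (show 0 < ε / 4 by positivity)
  obtain ⟨M, hM⟩ : ∃ M, ∀ t, |s t| ≤ M := by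
    obtain ⟨M, hM⟩ := isCompact_univ.exists_bound_of_continuousOn hs.continuousOn
    exact ⟨M, fun t => hM t (mem_univ t)⟩
  let S : Circle → ℝ := fun t => ∫ t' : Circle, poissonKernel 0 ((r : ℂ) * t) t' * s t' ∂m
  have hball : ∀ t : Circle, ‖(r : ℂ) * t‖ < 1 := norm_radial_lt hr0 hr1
  have hcont : ∀ ρ : Measure Circle, IsFiniteMeasure ρ → Continuous fun t' : Circle =>
      ∫ t : Circle, poissonKernel 0 ((r : ℂ) * t') t ∂ρ := by
    intro ρ _
    refine continuous_of_dominated (bound := fun _ => 2 / (1 - r))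
      (fun t' => (continuous_poissonKernel (hball t')).aestronglyMeasurable)
      (fun t' => .of_forall fun t => ?_) (integrable_const _) (.of_forall fun t => ?_)
    · rw [Real.norm_of_nonneg (poissonKernel_nonneg t (hball t'))]
      refine (poissonKernel_le t (hball t')).trans (le_of_eq ?_)
      rw [norm_mul, Circle.norm_coe, mul_one, Complex.norm_real, Real.norm_of_nonneg hr0]
    · simp_rw [poissonKernel_symm r t]
      exact continuous_poissonKernel (hball t)
  have hScont : Continuous S := by
    refine continuous_of_dominated (bound := fun _ => 2 / (1 - r) * M)
      (fun t' => ((continuous_poissonKernel (hball t')).mul hs).aestronglyMeasurable)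
      (fun t' => .of_forall fun t => ?_) (integrable_const _) (.of_forall fun t => ?_)
    · rw [norm_mul, Real.norm_of_nonneg (poissonKernel_nonneg t (hball t')), Real.norm_eq_abs]
      refine mul_le_mul ((poissonKernel_le t (hball t')).trans (le_of_eq ?_)) (hM t)
        (abs_nonneg _) (div_nonneg zero_le_two (by linarith))
      rw [norm_mul, Circle.norm_coe, mul_one, Complex.norm_real, Real.norm_of_nonneg hr0]
    · simp_rw [poissonKernel_symm r t]
      exact (continuous_poissonKernel (hball t)).mul continuous_const
  have hS : Tendsto (fun n => ∫ t, S t ∂(ν n)) atTop (𝓝 (∫ t, S t ∂μ)) := by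
    simp only [S, integral_integral_poissonKernel_swap hs hr0 hr1]
    refine tendsto_integral_of_dominated_convergence (fun _ => M * (2 / (1 - r)))
      (fun n => (hs.mul (hcont (ν n) inferInstance)).aestronglyMeasurable) (integrable_const _)
      (fun n => .of_forall fun t => ?_) (.of_forall fun t => (h _ (hball t)).const_mul _)
    rw [norm_mul, Real.norm_eq_abs]
    refine mul_le_mul (hM t) ?_ (norm_nonneg _) ((abs_nonneg _).trans (hM t))
    rw [Real.norm_of_nonneg (integral_nonneg fun t' => poissonKernel_nonneg t' (hball t))]
    calc _ ≤ ∫ _ : Circle, 2 / (1 - r) ∂(ν n) := by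
          refine integral_mono (integrable_poissonKernel (hball t)) (integrable_const _)
            fun t' => ?_
          refine (poissonKernel_le t' (hball t)).trans (le_of_eq ?_)
          rw [norm_mul, Circle.norm_coe, mul_one, Complex.norm_real, Real.norm_of_nonneg hr0]
      _ = _ := by simp
  have hclose : ∀ ρ : Measure Circle, IsProbabilityMeasure ρ →
      |∫ t, S t ∂ρ - ∫ t, s t ∂ρ| ≤ ε / 4 := by
    intro ρ _
    rw [← integral_sub (integrable_of_continuous hScont ρ) (integrable_of_continuous hs ρ)]
    calc _ ≤ ∫ t, ‖S t - s t‖ ∂ρ := norm_integral_le_integral_norm _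
      _ ≤ ∫ _ : Circle, ε / 4 ∂ρ := integral_mono
          (integrable_of_continuous (hScont.sub hs) ρ).norm (integrable_const _) hr
      _ = _ := by simp
  obtain ⟨N, hN⟩ := Metric.tendsto_atTop'.1 hS (ε / 4) (by positivity)
  refine ⟨N, fun n hn => ?_⟩
  have h1 := abs_le.1 (hclose (ν n) inferInstance)
  have h2 := abs_le.1 (hclose μ inferInstance)
  have h3 := hN n hn
  rw [Real.dist_eq, abs_lt] at h3 ⊢
  constructor <;> linarith

/-! ### Quantitative estimates -/

lemma measurable_cayleyRe : Measurable cayleyRe := by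
  unfold cayleyRe
  fun_prop

/-- With `X = √(cayleyRe w)` one has `2 (|w|² - Re w) = (1 - X²) |1 - w|²`. The bounds `|1 - w| ≤ 2`
and `X |1 - w| ≤ 1` give `(1 + X) |1 - w|² ≤ 6`, hence the constant `3`. -/
lemma norm_sq_le_re_add {w : ℂ} (hw : ‖w‖ < 1) :
    ‖w‖ ^ 2 ≤ w.re + 3 * |1 - √(cayleyRe w)| := by
  set X := √(cayleyRe w)
  have hX0 : 0 ≤ X := Real.sqrt_nonneg _
  have hd : 0 < ‖1 - w‖ := norm_pos_iff.2 (one_sub_ne_zero_of_norm_lt hw)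
  have hX : X ^ 2 * ‖1 - w‖ ^ 2 = 1 - ‖w‖ ^ 2 := by
    rw [Real.sq_sqrt (cayleyRe_pos hw).le, cayleyRe, div_mul_cancel₀ _ (by positivity)]
  have hd2 : ‖1 - w‖ ≤ 2 := by
    have := norm_sub_le 1 w
    rw [norm_one] at this
    linarith
  have hn : ‖1 - w‖ ^ 2 = 1 - 2 * w.re + ‖w‖ ^ 2 := by
    simp only [Complex.sq_norm, Complex.normSq_apply, Complex.sub_re, Complex.sub_im,
      Complex.one_re, Complex.one_im]
    ring
  have hXd : X * ‖1 - w‖ ≤ 1 := by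
    have : (X * ‖1 - w‖) ^ 2 ≤ 1 := by
      rw [mul_pow, hX]
      nlinarith [norm_nonneg w]
    nlinarith [mul_nonneg hX0 hd.le]
  have hcoef : (1 + X) * ‖1 - w‖ ^ 2 ≤ 6 := by nlinarith [mul_nonneg hX0 hd.le]
  have habs : (1 - X) * ((1 + X) * ‖1 - w‖ ^ 2) ≤ |1 - X| * 6 := by
    calc _ ≤ |1 - X| * ((1 + X) * ‖1 - w‖ ^ 2) := by
          gcongr
          exact le_abs_self _
      _ ≤ _ := by gcongr
  nlinarith

lemma abs_le_half_add_sq_div {y δ : ℝ} (hδ : 0 < δ) : |y| ≤ δ / 2 + y ^ 2 / (2 * δ) := by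
  rw [← sq_abs y, div_add_div _ _ two_ne_zero (by positivity), le_div_iff₀ (by positivity)]
  nlinarith [sq_nonneg (|y| - δ)]

lemma integrable_poissonKernel_mul_sqrt {H : Circle → ℂ} (hHm : AEStronglyMeasurable H m)
    (hH1 : ∀ᵐ t : Circle ∂m, ‖H t‖ < 1) {z : ℂ} (hz : ‖z‖ < 1)
    (hi : Integrable (fun t : Circle => poissonKernel 0 z t * cayleyRe (H t)) m) :
    Integrable (fun t : Circle => poissonKernel 0 z t * √(cayleyRe (H t))) m := by
  have hP := integrable_poissonKernel (ν := m) hz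
  refine (hP.add hi).mono' ((continuous_poissonKernel hz).aestronglyMeasurable.mul
    (measurable_cayleyRe.comp_aemeasurable hHm.aemeasurable).sqrt.aestronglyMeasurable) ?_
  filter_upwards [hH1] with t ht
  have h0 := poissonKernel_nonneg t hz
  have h1 := Real.sq_sqrt (cayleyRe_pos ht).le
  rw [Real.norm_of_nonneg (mul_nonneg h0 (Real.sqrt_nonneg _)), Pi.add_apply]
  nlinarith [sq_nonneg (√(cayleyRe (H t)) - 1), mul_nonneg h0 (Real.sqrt_nonneg (cayleyRe (H t))),
    mul_nonneg h0 (sq_nonneg (√(cayleyRe (H t)) - 1))]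

lemma integral_add_three_mul {f₁ f₂ f₃ f₄ : Circle → ℝ} (h₁ : Integrable f₁ m)
    (h₂ : Integrable f₂ m) (h₃ : Integrable f₃ m) (h₄ : Integrable f₄ m) (a b c : ℝ) :
    ∫ t, (f₁ t + 3 * (a * f₂ t + b * f₃ t - c * f₄ t)) ∂m =
      ∫ t, f₁ t ∂m + 3 * (a * ∫ t, f₂ t ∂m + b * ∫ t, f₃ t ∂m - c * ∫ t, f₄ t ∂m) := by
  have h₂₃ : Integrable (fun t => a * f₂ t + b * f₃ t) m := (h₂.const_mul a).add (h₃.const_mul b)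
  have h₂₃₄ : Integrable (fun t => a * f₂ t + b * f₃ t - c * f₄ t) m := h₂₃.sub (h₄.const_mul c)
  rw [integral_add h₁ (h₂₃₄.const_mul 3), integral_const_mul, integral_sub h₂₃ (h₄.const_mul c),
    integral_add (h₂.const_mul a) (h₃.const_mul b), integral_const_mul, integral_const_mul,
    integral_const_mul]

/-- The zero of `h` at `z` removes the integral of `P Re H` and bounds that of `P cayleyRe H` by
`1`, so the integral of `P (1 - √(cayleyRe H))²` is at most twice the defect `1 - ∫ P √(cayleyRe
H)`. The free `δ` linearizes `|1 - √(cayleyRe H)|`, in place of Cauchy-Schwarz. -/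
lemma integral_norm_sq_le {h : ℂ → ℂ} (hh : DifferentiableOn ℂ h (Metric.ball 0 1))
    (hh1 : ∀ z, ‖z‖ < 1 → ‖h z‖ < 1) {H : Circle → ℂ} (hHm : AEStronglyMeasurable H m)
    (hH : ∀ᵐ t : Circle ∂m, Tendsto (fun n => h (radius n * t)) atTop (𝓝 (H t)))
    (hH1 : ∀ᵐ t : Circle ∂m, ‖H t‖ < 1) {z : ℂ} (hz : ‖z‖ < 1) (hhz : h z = 0) {δ : ℝ}
    (hδ : 0 < δ) :
    ∫ t : Circle, poissonKernel 0 z t * ‖H t‖ ^ 2 ∂m ≤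
      3 * (δ / 2 + (1 - ∫ t : Circle, poissonKernel 0 z t * √(cayleyRe (H t)) ∂m) / δ) := by
  obtain ⟨hi, hle⟩ := integral_poissonKernel_mul_cayleyRe_le hh hh1 hH hH1 hz
  rw [hhz, show cayleyRe 0 = 1 by simp [cayleyRe]] at hle
  have hX := integrable_poissonKernel_mul_sqrt hHm hH1 hz hi
  have hP := integrable_poissonKernel (ν := m) hz
  have hHi : Integrable H m := Integrable.of_bound hHm 1 (hH1.mono fun t ht => ht.le)
  have hre : ∫ t : Circle, poissonKernel 0 z t * (H t).re ∂m = 0 := by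
    have hs : IsSchur h := ⟨hh, fun z hz => (hh1 z (by simpa using hz)).le⟩
    have h1 := hs.integral_poissonKernel_smul_radial hH hz
    have h2 := integral_re (integrable_poissonKernel_smul hHi hz)
    rw [h1, hhz] at h2
    simpa using h2
  have hRe : Integrable (fun t : Circle => poissonKernel 0 z t * (H t).re) m :=
    integrable_poissonKernel_mul hHi.re hz
  have hsq : Integrable (fun t : Circle => poissonKernel 0 z t * ‖H t‖ ^ 2) m := by
    refine integrable_poissonKernel_mul (Integrable.of_bound (hHm.norm.pow 2) 1 ?_) hz
    filter_upwards [hH1] with t ht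
    have : ‖‖H t‖ ^ 2‖ ≤ 1 := by
      rw [norm_pow, norm_norm]
      exact pow_le_one₀ (norm_nonneg _) ht.le
    exact this
  let c := 1 / (2 * δ)
  have hcomb : Integrable (fun t : Circle => poissonKernel 0 z t * (H t).re + 3 * (
      (δ / 2 + c) * poissonKernel 0 z t + c * (poissonKernel 0 z t * cayleyRe (H t)) -
        2 * c * (poissonKernel 0 z t * √(cayleyRe (H t))))) m :=
    hRe.add ((((hP.const_mul _).add (hi.const_mul _)).sub (hX.const_mul _)).const_mul _)
  calc _ ≤ ∫ t : Circle, (poissonKernel 0 z t * (H t).re + 3 * (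
      (δ / 2 + c) * poissonKernel 0 z t + c * (poissonKernel 0 z t * cayleyRe (H t)) -
        2 * c * (poissonKernel 0 z t * √(cayleyRe (H t))))) ∂m := by
        refine integral_mono_ae hsq hcomb ?_
        filter_upwards [hH1] with t ht
        have h0 := poissonKernel_nonneg t hz
        have h1 := norm_sq_le_re_add ht
        have h2 := abs_le_half_add_sq_div (y := 1 - √(cayleyRe (H t))) hδ
        have h3 := Real.sq_sqrt (cayleyRe_pos ht).le
        have h4 : (1 - √(cayleyRe (H t))) ^ 2 / (2 * δ) =
            c * (1 - 2 * √(cayleyRe (H t)) + cayleyRe (H t)) := by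
          simp only [c]
          rw [sub_sq, h3]
          ring
        rw [h4] at h2
        have h5 : ‖H t‖ ^ 2 ≤ (H t).re + 3 * (δ / 2 +
            c * (1 - 2 * √(cayleyRe (H t)) + cayleyRe (H t))) := by linarith
        have h6 := mul_le_mul_of_nonneg_left h5 h0
        linarith
    _ = 3 * ((δ / 2 + c) + c * ∫ t : Circle, poissonKernel 0 z t * cayleyRe (H t) ∂m -
        2 * c * ∫ t : Circle, poissonKernel 0 z t * √(cayleyRe (H t)) ∂m) := by
        rw [integral_add_three_mul hRe hP hi hX, hre, integral_poissonKernel hz]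
        ring
    _ ≤ 3 * ((δ / 2 + c) + c * 1 -
        2 * c * ∫ t : Circle, poissonKernel 0 z t * √(cayleyRe (H t)) ∂m) := by
        gcongr
    _ = _ := by
        simp only [c]
        field_simp
        ring

/-- AM-GM for `q, q, A`, in the factored form `w³ - 3 w q² + 2 q³ = (w - q)² (w + 2q)`. -/
lemma three_mul_le_of_cube_eq {A q w : ℝ} (hq : 0 < q) (hw : 0 ≤ w)
    (h : w ^ 3 = A * q ^ 2) : 3 * w ≤ 2 * q + A := by
  have hq2 : 0 < q ^ 2 := by positivity
  have : 0 ≤ (2 * q + A - 3 * w) * q ^ 2 := by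
    have : (2 * q + A - 3 * w) * q ^ 2 = (w - q) ^ 2 * (w + 2 * q) := by
      linear_combination -h
    rw [this]
    positivity
  nlinarith [nonneg_of_mul_nonneg_left this hq2]

/-- The cube root of the density of a measure. -/
def densityCbrt (μ : Measure Circle) (t : Circle) : ℝ := density μ t ^ (1 / 3 : ℝ)

lemma densityCbrt_nonneg (μ : Measure Circle) (t : Circle) : 0 ≤ densityCbrt μ t :=
  Real.rpow_nonneg (density_nonneg μ t) _

lemma densityCbrt_pow_three (μ : Measure Circle) (t : Circle) :
    densityCbrt μ t ^ 3 = density μ t := by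
  rw [densityCbrt, ← Real.rpow_natCast, ← Real.rpow_mul (density_nonneg μ t)]
  norm_num

lemma measurable_density (μ : Measure Circle) : Measurable (density μ) :=
  (Measure.measurable_rnDeriv _ _).ennreal_toReal

lemma measurable_densityCbrt (μ : Measure Circle) : Measurable (densityCbrt μ) :=
  (measurable_density μ).pow_const _

lemma integrable_densityCbrt (μ : Measure Circle) [IsFiniteMeasure μ] :
    Integrable (densityCbrt μ) m := by
  refine ((integrable_const 1).add (integrable_density μ)).mono'
    (measurable_densityCbrt μ).aestronglyMeasurable (.of_forall fun t => ?_)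
  rw [Real.norm_of_nonneg (densityCbrt_nonneg μ t), Pi.add_apply, ← densityCbrt_pow_three]
  have := densityCbrt_nonneg μ t
  rcases le_total (densityCbrt μ t) 1 with h | h
  · have : 0 ≤ densityCbrt μ t ^ 3 := by positivity
    linarith
  · have := le_self_pow₀ h (n := 3) (by norm_num)
    linarith

/-- The lower bound for the integral of the square root of `q`, when `x * q` is the density of
`μ`. -/
lemma le_integral_sqrt {μ : Measure Circle} [IsFiniteMeasure μ] {x : Circle → ℝ}
    (hx : Continuous x) {q : Circle → ℝ} (hq : ∀ᵐ t ∂m, 0 < q t)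
    (hxq : ∀ᵐ t ∂m, density μ t = x t * q t) {z : ℂ} (hz : ‖z‖ < 1)
    (hi : Integrable (fun t : Circle => poissonKernel 0 z t * √(q t)) m) {s : Circle → ℝ}
    (hs : Continuous s) (hs0 : ∀ t, 0 ≤ s t) :
    3 * ∫ t : Circle, poissonKernel 0 z t * (s t * densityCbrt μ t) ∂m -
      ∫ t : Circle, poissonKernel 0 z t * (s t ^ 3 * x t) ∂m ≤
      2 * ∫ t : Circle, poissonKernel 0 z t * √(q t) ∂m := by
  have h1 : Integrable (fun t : Circle => poissonKernel 0 z t * (s t ^ 3 * x t)) m :=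
    integrable_poissonKernel_mul (integrable_of_continuous ((hs.pow 3).mul hx) m) hz
  have h2 : Integrable (fun t : Circle => poissonKernel 0 z t * (s t * densityCbrt μ t)) m := by
    refine integrable_poissonKernel_mul ?_ hz
    obtain ⟨M, hM⟩ := isCompact_univ.exists_bound_of_continuousOn hs.continuousOn
    exact (integrable_densityCbrt μ).bdd_mul hs.aestronglyMeasurable
      (.of_forall fun t => hM t (mem_univ t))
  rw [sub_le_iff_le_add, ← integral_const_mul, ← integral_const_mul,
    ← integral_add (hi.const_mul 2) h1]
  refine integral_mono_ae (h2.const_mul 3) ((hi.const_mul 2).add h1) ?_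
  filter_upwards [hq, hxq] with t hqt hxqt
  have h0 := poissonKernel_nonneg t hz
  -- The cube root is the exponent that makes AM-GM fit: `(s μ'^(1/3))³ = (s³ x) (√q)²`, leaving `x`
  -- to the first power.
  have h3 := three_mul_le_of_cube_eq (A := s t ^ 3 * x t) (q := √(q t))
    (w := s t * densityCbrt μ t) (Real.sqrt_pos.2 hqt)
    (mul_nonneg (hs0 t) (densityCbrt_nonneg μ t)) (by
      rw [mul_pow, densityCbrt_pow_three, Real.sq_sqrt hqt.le, hxqt]
      ring)
  have := mul_le_mul_of_nonneg_left h3 h0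
  linarith

/-! ### Nodes converging to the circle -/

/-- Transfers convergence of averages from the density to its cube root at a point where the density
is positive. -/
lemma abs_sub_le_div_of_cube {v v₀ : ℝ} (hv : 0 ≤ v) (hv₀ : 0 < v₀) :
    |v - v₀| ≤ |v ^ 3 - v₀ ^ 3| / v₀ ^ 2 := by
  rw [le_div_iff₀ (by positivity)]
  have h : v ^ 3 - v₀ ^ 3 = (v - v₀) * (v ^ 2 + v * v₀ + v₀ ^ 2) := by ring
  rw [h, abs_mul, abs_of_pos (show 0 < v ^ 2 + v * v₀ + v₀ ^ 2 by positivity)]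
  gcongr
  nlinarith

lemma eventually_le_of_tendsto_circle {μ : Measure Circle} [IsFiniteMeasure μ] {z : ℕ → ℂ}
    {ξ : Circle} (hz : Tendsto z atTop (𝓝[Metric.ball 0 1] (ξ : ℂ)))
    (hξ : ξ ∉ (μ.singularPart m).support) {h : Circle → ℝ} (hh : h =ᵐ[m] density μ)
    (hpos : 0 < h ξ)
    (hlim : Tendsto (fun k => ∫ t : Circle, poissonKernel 0 (z k) t * ‖h t - h ξ‖ ∂m) atTop
      (𝓝 0))
    {x : ℕ → Circle → ℝ}
    (hx : ∀ᶠ k in atTop, ∫ t : Circle, poissonKernel 0 (z k) t * x k t ∂m =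
      ∫ t : Circle, poissonKernel 0 (z k) t ∂μ) {I : ℕ → ℝ}
    (hI : ∀ k, ∀ s : Circle → ℝ, Continuous s → (∀ t, 0 ≤ s t) →
      3 * ∫ t : Circle, poissonKernel 0 (z k) t * (s t * densityCbrt μ t) ∂m -
        ∫ t : Circle, poissonKernel 0 (z k) t * (s t ^ 3 * x k t) ∂m ≤ 2 * I k)
    {ε : ℝ} (hε : 0 < ε) : ∀ᶠ k in atTop, 1 - ε ≤ I k := by
  have hhi : Integrable h m := (integrable_density μ).congr hh.symm
  set v₀ := h ξ ^ (1 / 3 : ℝ) with hv₀def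
  have hv₀ : 0 < v₀ := Real.rpow_pos_of_pos hpos _
  have hv₀3 : v₀ ^ 3 = h ξ := by
    rw [hv₀def, ← Real.rpow_natCast, ← Real.rpow_mul hpos.le]
    norm_num
  have hball : ∀ᶠ k in atTop, ‖z k‖ < 1 := hz.eventually (eventually_norm_lt_one le_rfl)
  have h1 : Tendsto (fun k => ∫ t : Circle, poissonKernel 0 (z k) t * h t ∂m) atTop
      (𝓝 (h ξ)) :=
    tendsto_map'_iff.1 (tendsto_integral_poissonKernel_smul (l := map z atTop) hhi hz
      (tendsto_map'_iff.2 hlim))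
  have h2 : Tendsto (fun k => ∫ t : Circle, poissonKernel 0 (z k) t * densityCbrt μ t ∂m) atTop
      (𝓝 v₀) := by
    refine tendsto_map'_iff.1 (tendsto_integral_poissonKernel_smul (l := map z atTop)
      (integrable_densityCbrt μ) hz (tendsto_map'_iff.2 ?_))
    have h3 := hlim.const_mul (1 / v₀ ^ 2)
    rw [mul_zero] at h3
    refine squeeze_zero' ?_ ?_ h3
    · filter_upwards [hball] with k hk
      exact integral_nonneg fun t => mul_nonneg (poissonKernel_nonneg t hk) (norm_nonneg _)
    · filter_upwards [hball] with k hk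
      simp only [Function.comp]
      rw [← integral_const_mul]
      refine integral_mono_ae
        (integrable_poissonKernel_mul ((integrable_densityCbrt μ).sub (integrable_const _)).norm hk)
        ((integrable_poissonKernel_mul (hhi.sub (integrable_const _)).norm hk).const_mul _) ?_
      filter_upwards [hh] with t ht
      have h4 := abs_sub_le_div_of_cube (densityCbrt_nonneg μ t) hv₀
      rw [densityCbrt_pow_three, ← ht, hv₀3] at h4
      calc _ ≤ poissonKernel 0 (z k) t * (|h t - h ξ| / v₀ ^ 2) :=
            mul_le_mul_of_nonneg_left h4 (poissonKernel_nonneg t hk)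
        _ = _ := by
            rw [Real.norm_eq_abs]
            ring
  -- Off the support of the singular part, `ξ` has a ball that is null for it, so only the
  -- absolutely continuous part contributes to the limit.
  have h3 : Tendsto (fun k => ∫ t : Circle, poissonKernel 0 (z k) t ∂μ) atTop (𝓝 (h ξ)) := by
    obtain ⟨U, hU, hU0⟩ := Measure.notMem_support_iff_exists.1 hξ
    obtain ⟨r, hr, hrU⟩ := Metric.mem_nhds_iff.1 hU
    have h4 := (tendsto_integral_poissonKernel_of_ball_null hr
      (measure_mono_null hrU hU0)).comp hz
    have h5 := h4.add h1
    rw [zero_add] at h5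
    refine h5.congr' ?_
    filter_upwards [hball] with k hk
    rw [integral_eq_singularPart_add μ (integrable_poissonKernel hk)]
    refine congrArg₂ _ rfl (integral_congr_ae ?_)
    filter_upwards [hh] with t ht
    rw [ht]
  have h4 : Tendsto (fun k => 3 * ((1 / v₀) *
      ∫ t : Circle, poissonKernel 0 (z k) t * densityCbrt μ t ∂m) -
      (1 / v₀) ^ 3 * ∫ t : Circle, poissonKernel 0 (z k) t ∂μ) atTop (𝓝 2) := by
    have h5 := ((h2.const_mul (1 / v₀)).const_mul 3).sub (h3.const_mul ((1 / v₀) ^ 3))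
    have h6 : 3 * (1 / v₀ * v₀) - (1 / v₀) ^ 3 * h ξ = 2 := by
      rw [← hv₀3]
      field_simp
      norm_num
    rwa [h6] at h5
  filter_upwards [h4.eventually (Ioi_mem_nhds (show 2 - 2 * ε < 2 by linarith)), hx]
    with k hk hxk
  have hk : 2 - 2 * ε < _ := hk
  have h5 := hI k (fun _ => 1 / v₀) continuous_const fun _ => by positivity
  simp_rw [mul_left_comm _ (1 / v₀), mul_left_comm _ ((1 / v₀) ^ 3)] at h5
  rw [integral_const_mul, integral_const_mul, hxk] at h5
  linarith

/-! ### Nodes converging inside the disk -/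

lemma exists_seq_continuous_tendsto_ae (ρ : Measure Circle) [IsFiniteMeasure ρ] {w : Circle → ℝ}
    (hw : Measurable w) {N : ℝ} (hw0 : ∀ t, 0 ≤ w t) (hwN : ∀ t, w t ≤ N) :
    ∃ s : ℕ → Circle → ℝ, (∀ j, Continuous (s j)) ∧ (∀ j t, 0 ≤ s j t) ∧ (∀ j t, s j t ≤ N) ∧
      ∀ᵐ t ∂ρ, Tendsto (fun j => s j t) atTop (𝓝 (w t)) := by
  have hN : 0 ≤ N := (hw0 1).trans (hwN 1)
  have hmem : MemLp w 1 ρ := MemLp.of_bound hw.aestronglyMeasurable N (.of_forall fun t => by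
    rw [Real.norm_of_nonneg (hw0 t)]
    exact hwN t)
  have hex : ∀ j : ℕ, ∃ g : BoundedContinuousFunction Circle ℝ,
      eLpNorm (w - ⇑g) 1 ρ ≤ ((j : ENNReal) + 1)⁻¹ ∧ MemLp g 1 ρ := fun j =>
    hmem.exists_boundedContinuous_eLpNorm_sub_le (by norm_num) (by simp)
  choose g hg hgm using hex
  have hlim : Tendsto (fun j => eLpNorm (⇑(g j) - w) 1 ρ) atTop (𝓝 0) := by
    refine tendsto_of_tendsto_of_tendsto_of_le_of_le tendsto_const_nhds
      (h := fun j : ℕ => ((j : ENNReal) + 1)⁻¹) ?_ (fun _ => zero_le) fun j => ?_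
    · have := ENNReal.tendsto_inv_nat_nhds_zero.comp (tendsto_add_atTop_nat 1)
      refine this.congr fun j => ?_
      simp
    · simp only
      rw [eLpNorm_sub_comm]
      exact hg j
  obtain ⟨ns, -, hns⟩ := (tendstoInMeasure_of_tendsto_eLpNorm one_ne_zero
    (fun j => (hgm j).1) hw.aestronglyMeasurable hlim).exists_seq_tendsto_ae
  -- Clipping to `[0, N]` keeps continuity and the a.e. limit, as `w` already takes values there,
  -- and supplies a constant majorant.
  refine ⟨fun j t => max 0 (min (g (ns j) t) N), fun j => ?_, fun j t => le_max_left _ _,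
    fun j t => max_le hN (min_le_right _ _), ?_⟩
  · exact continuous_const.max ((g (ns j)).continuous.min continuous_const)
  · filter_upwards [hns] with t ht
    have h1 := (tendsto_const_nhds (x := (0 : ℝ))).max
      (ht.min (tendsto_const_nhds (x := N)))
    rwa [min_eq_left (hwN t), max_eq_right (hw0 t)] at h1

lemma densityCbrt_pos {μ : Measure Circle} {t : Circle} (h : 0 < density μ t) :
    0 < densityCbrt μ t := Real.rpow_pos_of_pos h _

/-- The ideal choice is the inverse cube root of the density off a set carrying the singular part,
and `0` on that set: both integrals are then `1`. It is truncated to be bounded and then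
approximated by continuous functions. -/
lemma exists_continuous_testFunction {μ : Measure Circle} [IsFiniteMeasure μ]
    (hpos : ∀ᵐ t ∂m, 0 < density μ t) {a : ℂ} (ha : ‖a‖ < 1) {ε : ℝ} (hε : 0 < ε) :
    ∃ s : Circle → ℝ, Continuous s ∧ (∀ t, 0 ≤ s t) ∧
      2 - ε < 3 * ∫ t : Circle, poissonKernel 0 a t * (s t * densityCbrt μ t) ∂m -
        ∫ t : Circle, poissonKernel 0 a t * s t ^ 3 ∂μ := by
  -- `E` has full `m`-measure and is null for the singular part, so cutting `w` off outside `E`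
  -- hides the singular part from the cubic term.
  obtain ⟨E, hE, hE1, hE2⟩ := Measure.mutuallySingular_singularPart μ m
  have hv := measurable_densityCbrt μ
  have hv0 := densityCbrt_nonneg μ
  have hP := fun t : Circle => poissonKernel_nonneg t ha
  have hPm := integrable_poissonKernel (ν := m) ha
  have hPc := continuous_poissonKernel ha
  let w : ℕ → Circle → ℝ := fun N => E.indicator fun t => min (N : ℝ) (densityCbrt μ t)⁻¹
  have hw : ∀ N, Measurable (w N) := fun N => (measurable_const.min hv.inv).indicator hE
  have hw0 : ∀ N t, 0 ≤ w N t := fun N t =>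
    indicator_nonneg (fun t _ => le_min (Nat.cast_nonneg N) (inv_nonneg.2 (hv0 t))) t
  have hwN : ∀ N t, w N t ≤ N := fun N t =>
    indicator_le' (fun t _ => min_le_left _ _) (fun _ _ => Nat.cast_nonneg N) t
  have hwv : ∀ N t, w N t * densityCbrt μ t ≤ 1 := by
    intro N t
    by_cases ht : t ∈ E
    · simp only [w, indicator_of_mem ht]
      calc _ ≤ (densityCbrt μ t)⁻¹ * densityCbrt μ t :=
            mul_le_mul_of_nonneg_right (min_le_right _ _) (hv0 t)
        _ ≤ 1 := inv_mul_le_one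
    · simp [w, ht]
  have hlim : Tendsto (fun N => ∫ t : Circle, poissonKernel 0 a t * (w N t * densityCbrt μ t) ∂m)
      atTop (𝓝 1) := by
    rw [← integral_poissonKernel ha]
    refine tendsto_integral_of_dominated_convergence (fun t : Circle => poissonKernel 0 a t)
      (fun N => hPc.aestronglyMeasurable.mul ((hw N).mul hv).aestronglyMeasurable) hPm
      (fun N => .of_forall fun t => ?_) ?_
    · rw [Real.norm_of_nonneg (mul_nonneg (hP t) (mul_nonneg (hw0 N t) (hv0 t)))]
      exact mul_le_of_le_one_right (hP t) (hwv N t)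
    · have hEm : ∀ᵐ t ∂m, t ∈ E := hE2
      filter_upwards [hpos, hEm] with t ht htE
      refine tendsto_const_nhds.congr' ?_
      obtain ⟨N, hN⟩ := exists_nat_ge (densityCbrt μ t)⁻¹
      filter_upwards [eventually_ge_atTop N] with n hn
      have h1 : (densityCbrt μ t)⁻¹ ≤ (n : ℝ) := hN.trans (by exact_mod_cast hn)
      simp only [w, indicator_of_mem htE, min_eq_right h1]
      rw [inv_mul_cancel₀ (densityCbrt_pos ht).ne', mul_one]
  have hcube : ∀ N, ∫ t : Circle, poissonKernel 0 a t * w N t ^ 3 ∂μ ≤ 1 := by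
    intro N
    have hi : ∀ ν : Measure Circle, IsFiniteMeasure ν →
        Integrable (fun t : Circle => poissonKernel 0 a t * w N t ^ 3) ν := by
      intro ν _
      refine integrable_poissonKernel_mul (Integrable.of_bound
        ((hw N).pow_const 3).aestronglyMeasurable ((N : ℝ) ^ 3) (.of_forall fun t => ?_)) ha
      rw [Real.norm_of_nonneg (pow_nonneg (hw0 N t) 3)]
      exact pow_le_pow_left₀ (hw0 N t) (hwN N t) 3
    rw [integral_eq_singularPart_add μ (hi μ inferInstance)]
    have h1 : ∫ t : Circle, poissonKernel 0 a t * w N t ^ 3 ∂(μ.singularPart m) = 0 := by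
      refine integral_eq_zero_of_ae ?_
      have hEs : ∀ᵐ t ∂(μ.singularPart m), t ∉ E := by
        rw [ae_iff]
        simpa using hE1
      filter_upwards [hEs] with t ht
      simp [w, ht]
    have hle : ∀ t : Circle, poissonKernel 0 a t * w N t ^ 3 * density μ t ≤
        poissonKernel 0 a t := by
      intro t
      rw [← densityCbrt_pow_three, mul_assoc, ← mul_pow]
      exact mul_le_of_le_one_right (hP t)
        (pow_le_one₀ (mul_nonneg (hw0 N t) (hv0 t)) (hwv N t))
    have hnn : ∀ t : Circle, 0 ≤ poissonKernel 0 a t * w N t ^ 3 * density μ t := fun t =>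
      mul_nonneg (mul_nonneg (hP t) (pow_nonneg (hw0 N t) 3)) (density_nonneg μ t)
    rw [h1, zero_add, ← integral_poissonKernel ha]
    exact integral_mono_of_nonneg (.of_forall hnn) hPm (.of_forall hle)
  obtain ⟨N, hN⟩ := (hlim.eventually (Ioi_mem_nhds
    (show 1 - ε / 6 < 1 by linarith))).exists
  have hN : 1 - ε / 6 < _ := hN
  -- Approximation with respect to `m + μ` gives convergence almost everywhere for both measures, as
  -- the two integrals require.
  obtain ⟨s, hsc, hs0, hsN, hs⟩ := exists_seq_continuous_tendsto_ae (m + μ) (hw N) (hw0 N) (hwN N)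
  rw [ae_add_measure_iff] at hs
  have h1 : Tendsto (fun j => ∫ t : Circle, poissonKernel 0 a t * (s j t * densityCbrt μ t) ∂m)
      atTop (𝓝 (∫ t : Circle, poissonKernel 0 a t * (w N t * densityCbrt μ t) ∂m)) := by
    refine tendsto_integral_of_dominated_convergence
      (fun t : Circle => poissonKernel 0 a t * (N * densityCbrt μ t))
      (fun j => hPc.aestronglyMeasurable.mul
        ((hsc j).measurable.mul hv).aestronglyMeasurable)
      (integrable_poissonKernel_mul ((integrable_densityCbrt μ).const_mul _) ha)
      (fun j => .of_forall fun t => ?_) ?_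
    · rw [Real.norm_of_nonneg (mul_nonneg (hP t) (mul_nonneg (hs0 j t) (hv0 t)))]
      exact mul_le_mul_of_nonneg_left (mul_le_mul_of_nonneg_right (hsN j t) (hv0 t)) (hP t)
    · filter_upwards [hs.1] with t ht using (ht.mul_const _).const_mul _
  have h2 : Tendsto (fun j => ∫ t : Circle, poissonKernel 0 a t * s j t ^ 3 ∂μ)
      atTop (𝓝 (∫ t : Circle, poissonKernel 0 a t * w N t ^ 3 ∂μ)) := by
    refine tendsto_integral_of_dominated_convergence
      (fun t : Circle => poissonKernel 0 a t * (N : ℝ) ^ 3)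
      (fun j => (hPc.mul ((hsc j).pow 3)).aestronglyMeasurable)
      (integrable_poissonKernel_mul (integrable_const _) ha)
      (fun j => .of_forall fun t => ?_) ?_
    · rw [Real.norm_of_nonneg (mul_nonneg (hP t) (pow_nonneg (hs0 j t) 3))]
      exact mul_le_mul_of_nonneg_left (pow_le_pow_left₀ (hs0 j t) (hsN j t) 3) (hP t)
    · filter_upwards [hs.2] with t ht using (ht.pow 3).const_mul _
  have h3 := (h1.const_mul 3).sub h2
  obtain ⟨j, hj⟩ := (h3.eventually (Ioi_mem_nhds (show 2 - ε < _ by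
    have := hcube N
    linarith))).exists
  exact ⟨s j, hsc j, hs0 j, hj⟩

lemma tendstoUniformly_poissonKernel {z : ℕ → ℂ} {a : ℂ} (ha : ‖a‖ < 1)
    (hz : Tendsto z atTop (𝓝 a)) :
    TendstoUniformly (fun k (t : Circle) => poissonKernel 0 (z k) t)
      (fun t : Circle => poissonKernel 0 a t) atTop := by
  have hc : ContinuousOn (fun p : ℂ × Circle => poissonKernel 0 p.1 p.2)
      (Metric.ball 0 1 ×ˢ univ) := by
    simp_rw [poissonKernel_circle]
    refine ContinuousOn.div (by fun_prop) (by fun_prop) fun p hp => ?_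
    exact pow_ne_zero 2 (norm_ne_zero_iff.2
      (circle_sub_ne_zero p.2 (by simpa using hp.1)))
  have h := ContinuousOn.tendstoUniformly (f := fun (w : ℂ) (t : Circle) => poissonKernel 0 w t)
    (Metric.isOpen_ball.mem_nhds (show a ∈ Metric.ball 0 1 by simpa using ha)) hc
  intro u hu
  exact hz.eventually (h u hu)

lemma eventually_le_of_tendsto_disk {μ : Measure Circle} [IsProbabilityMeasure μ]
    (hpos : ∀ᵐ t ∂m, 0 < density μ t) {z : ℕ → ℂ} {a : ℂ} (ha : ‖a‖ < 1)
    (hz1 : ∀ k, ‖z k‖ < 1) (hz : Tendsto z atTop (𝓝 a)) {x : ℕ → Circle → ℝ}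
    (hxc : ∀ k, Continuous (x k)) (hx0 : ∀ k t, 0 ≤ x k t)
    (hx : ∀ S : Circle → ℝ, Continuous S →
      Tendsto (fun k => ∫ t, S t * x k t ∂m) atTop (𝓝 (∫ t, S t ∂μ))) {I : ℕ → ℝ}
    (hI : ∀ k, ∀ s : Circle → ℝ, Continuous s → (∀ t, 0 ≤ s t) →
      3 * ∫ t : Circle, poissonKernel 0 (z k) t * (s t * densityCbrt μ t) ∂m -
        ∫ t : Circle, poissonKernel 0 (z k) t * (s t ^ 3 * x k t) ∂m ≤ 2 * I k)
    {ε : ℝ} (hε : 0 < ε) : ∀ᶠ k in atTop, 1 - ε ≤ I k := by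
  obtain ⟨s, hs, hs0, hsε⟩ := exists_continuous_testFunction hpos ha
    (show 0 < 2 * ε by positivity)
  have hPa := continuous_poissonKernel ha
  have hunif := Metric.tendstoUniformly_iff.1 (tendstoUniformly_poissonKernel ha hz)
  -- The moving kernel may be replaced by the one at `a`: the kernels converge uniformly, and the
  -- functions they multiply are bounded in `L¹(m)`.
  have key : ∀ g : ℕ → Circle → ℝ, (∀ k, Integrable (g k) m) → ∀ B : ℝ, 0 ≤ B →
      (∀ᶠ k in atTop, ∫ t, |g k t| ∂m ≤ B) → ∀ L : ℝ,
      Tendsto (fun k => ∫ t : Circle, poissonKernel 0 a t * g k t ∂m) atTop (𝓝 L) →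
      Tendsto (fun k => ∫ t : Circle, poissonKernel 0 (z k) t * g k t ∂m) atTop (𝓝 L) := by
    intro g hg B hB hgB L hL
    have hdiff : Tendsto (fun k => ∫ t : Circle, poissonKernel 0 (z k) t * g k t ∂m -
        ∫ t : Circle, poissonKernel 0 a t * g k t ∂m) atTop (𝓝 0) := by
      rw [Metric.tendsto_nhds]
      intro η hη
      filter_upwards [hunif (η / (B + 1)) (by positivity), hgB] with k hk hkB
      rw [Real.dist_0_eq_abs, ← integral_sub (integrable_poissonKernel_mul (hg k) (hz1 k))
        (integrable_poissonKernel_mul (hg k) ha)]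
      calc |∫ t : Circle, (poissonKernel 0 (z k) t * g k t - poissonKernel 0 a t * g k t) ∂m|
          ≤ ∫ t : Circle, η / (B + 1) * |g k t| ∂m := by
            rw [← Real.norm_eq_abs]
            refine norm_integral_le_of_norm_le ((hg k).abs.const_mul _) (.of_forall fun t => ?_)
            rw [← sub_mul, norm_mul, Real.norm_eq_abs (g k t)]
            refine mul_le_mul_of_nonneg_right ?_ (abs_nonneg _)
            have := hk t
            rw [dist_comm, dist_eq_norm] at this
            exact this.le
        _ = η / (B + 1) * ∫ t, |g k t| ∂m := integral_const_mul _ _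
        _ ≤ η / (B + 1) * B := by gcongr
        _ < η := by
            rw [div_mul_eq_mul_div, div_lt_iff₀ (by positivity)]
            nlinarith
    simpa using hdiff.add hL
  obtain ⟨M, hM⟩ := isCompact_univ.exists_bound_of_continuousOn hs.continuousOn
  have hsv : Integrable (fun t => s t * densityCbrt μ t) m :=
    (integrable_densityCbrt μ).bdd_mul hs.aestronglyMeasurable
      (.of_forall fun t => hM t (mem_univ t))
  have h1 := key (fun _ t => s t * densityCbrt μ t) (fun _ => hsv) _
    (integral_nonneg fun t => abs_nonneg _) (.of_forall fun _ => le_rfl) _ tendsto_const_nhds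
  have hlim3 := hx (fun t => s t ^ 3) (hs.pow 3)
  have h2 := key (fun k t => s t ^ 3 * x k t)
    (fun k => integrable_of_continuous ((hs.pow 3).mul (hxc k)) m) (|∫ t, s t ^ 3 ∂μ| + 1)
    (by positivity) (by
      have h3 : ∀ᶠ k in atTop, ∫ t, s t ^ 3 * x k t ∂m < |∫ t, s t ^ 3 ∂μ| + 1 :=
        hlim3.eventually (Iio_mem_nhds (by linarith [le_abs_self (∫ t, s t ^ 3 ∂μ)]))
      filter_upwards [h3] with k hk
      refine le_trans (le_of_eq ?_) hk.le
      refine integral_congr_ae (.of_forall fun t => ?_)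
      exact abs_of_nonneg (mul_nonneg (pow_nonneg (hs0 t) 3) (hx0 k t)))
    (∫ t : Circle, poissonKernel 0 a t * s t ^ 3 ∂μ) (by
      have := hx (fun t : Circle => poissonKernel 0 a t * s t ^ 3) (hPa.mul (hs.pow 3))
      simpa only [mul_assoc] using this)
  have h3 := (h1.const_mul 3).sub h2
  filter_upwards [h3.eventually (Ioi_mem_nhds hsε)] with k hk
  have hk : 2 - 2 * ε < _ := hk
  have := hI k s hs hs0
  linarith

/-! ### Schur remainders of a function -/

section Remainders

variable {α : ℕ → ℂ} {f : ℂ → ℂ}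

/-- The Schur parameters of `f`. -/
def schurParameter (α : ℕ → ℂ) (f : ℂ → ℂ) (k : ℕ) : ℂ := schurRemainder α f k (α (k + 1))

lemma isStrictSchur_schurRemainder (hα : ∀ k, ‖α k‖ < 1) (hf : IsStrictSchur f) (k : ℕ) :
    IsStrictSchur (schurRemainder α f k) := by
  induction k with
  | zero => exact hf
  | succ k ih => exact (ih.schurStep (hα (k + 1))).1

lemma norm_schurParameter_lt_one (hα : ∀ k, ‖α k‖ < 1) (hf : IsStrictSchur f) (k : ℕ) :
    ‖schurParameter α f k‖ < 1 :=
  (isStrictSchur_schurRemainder hα hf k).norm_lt_one _ (hα _)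

lemma schurRemainder_eq_moebius (hα : ∀ k, ‖α k‖ < 1) (hf : IsStrictSchur f) (k : ℕ) {z : ℂ}
    (hz : ‖z‖ < 1) : schurRemainder α f k z =
      moebius (blaschke (α (k + 1)) z) (schurParameter α f k) (schurRemainder α f (k + 1) z) :=
  moebius_of_mul_eq_blaschke (norm_schurParameter_lt_one hα hf k)
    ((isStrictSchur_schurRemainder hα hf k).norm_lt_one z hz)
    (blaschke_mul_schurStep (hα (k + 1)) hz)

/-- The interpolant of `f` at the nodes `α 1, …, α n`. -/
def schurInterpolant (α : ℕ → ℂ) (f : ℂ → ℂ) (n : ℕ) : ℂ → ℂ :=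
  interpolant (fun k => α (k + 1)) (schurParameter α f) n 0

/-- The density of the Herglotz measure of the interpolant of `f`. -/
def interpolantDensity (α : ℕ → ℂ) (f : ℂ → ℂ) (n : ℕ) (t : Circle) : ℝ :=
  cayleyRe (t * schurInterpolant α f n t)

/-- The finite Blaschke product paired with the `n`-th Schur remainder. -/
def schurCofactor (α : ℕ → ℂ) (f : ℂ → ℂ) : ℕ → ℂ → ℂ :=
  cofactor (fun k => α (k + 1)) (schurParameter α f)

/-- The boundary values of the product of a Schur remainder and its cofactor. -/
def remainderTrace (α : ℕ → ℂ) (f : ℂ → ℂ) (n : ℕ) (t : Circle) : ℂ :=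
  schurCofactor α f n t * trace (schurRemainder α f n) t

lemma diffContOnCl_schurInterpolant (hα : ∀ k, ‖α k‖ < 1) (hf : IsStrictSchur f) (n : ℕ) :
    DiffContOnCl ℂ (fun z => z * schurInterpolant α f n z) (Metric.ball 0 1) :=
  differentiable_id.diffContOnCl.smul (diffContOnCl_interpolant (fun k => hα (k + 1))
    (norm_schurParameter_lt_one hα hf) n 0)

lemma norm_mul_schurInterpolant_lt_one (hα : ∀ k, ‖α k‖ < 1) (hf : IsStrictSchur f) (n : ℕ)
    {z : ℂ} (hz : ‖z‖ ≤ 1) : ‖z * schurInterpolant α f n z‖ < 1 := by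
  have := norm_interpolant_lt_one (fun k => hα (k + 1)) (norm_schurParameter_lt_one hα hf) n 0 hz
  rw [norm_mul]
  exact (mul_le_of_le_one_left (norm_nonneg _) hz).trans_lt this

lemma interpolantDensity_pos (hα : ∀ k, ‖α k‖ < 1) (hf : IsStrictSchur f) (n : ℕ) (t : Circle) :
    0 < interpolantDensity α f n t :=
  cayleyRe_pos (norm_mul_schurInterpolant_lt_one hα hf n (Circle.norm_coe t).le)

lemma continuous_interpolantDensity (hα : ∀ k, ‖α k‖ < 1) (hf : IsStrictSchur f) (n : ℕ) :
    Continuous (interpolantDensity α f n) := by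
  have h := (diffContOnCl_schurInterpolant hα hf n).2
  rw [closure_ball _ one_ne_zero] at h
  have hc : Continuous fun t : Circle => (t : ℂ) * schurInterpolant α f n t :=
    h.comp_continuous (by fun_prop) (by simp [Circle.norm_coe])
  exact continuous_iff_continuousAt.2 fun t =>
    ContinuousAt.comp (f := fun t : Circle => (t : ℂ) * schurInterpolant α f n t)
      (continuousAt_cayleyRe (norm_mul_schurInterpolant_lt_one hα hf n (Circle.norm_coe t).le))
      hc.continuousAt

lemma integral_poissonKernel_mul_interpolantDensity (hα : ∀ k, ‖α k‖ < 1)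
    (hf : IsStrictSchur f) (n : ℕ) {z : ℂ} (hz : ‖z‖ < 1) :
    ∫ t : Circle, poissonKernel 0 z t * interpolantDensity α f n t ∂m =
      cayleyRe (z * schurInterpolant α f n z) :=
  integral_poissonKernel_mul_cayleyRe (diffContOnCl_schurInterpolant hα hf n)
    (fun _ hw => norm_mul_schurInterpolant_lt_one hα hf n hw) hz

lemma norm_sub_schurInterpolant_le (hα : ∀ k, ‖α k‖ < 1) (hf : IsStrictSchur f) (n : ℕ) {z : ℂ}
    (hz : ‖z‖ < 1) : ‖f z - schurInterpolant α f n z‖ ≤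
      2 * ∏ j ∈ Finset.range n, ‖blaschke (α (j + 1)) z‖ :=
  norm_sub_interpolant_le (fun k => hα (k + 1)) (norm_schurParameter_lt_one hα hf)
    (fun k => (isStrictSchur_schurRemainder hα hf k).differentiableOn)
    (fun k => (isStrictSchur_schurRemainder hα hf k).norm_lt_one)
    (fun k _ hz => schurRemainder_eq_moebius hα hf k hz) n hz

/-- For `n ≥ 1` the Blaschke product in the error bound contains the factor with zero `α n`; for `n
= 0` the product is empty. -/
lemma schurInterpolant_node (hα : ∀ k, ‖α k‖ < 1) (hf : IsStrictSchur f) {n : ℕ} (hn : n ≠ 0) :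
    schurInterpolant α f n (α n) = f (α n) := by
  have h := norm_sub_schurInterpolant_le hα hf n (hα n)
  obtain ⟨k, rfl⟩ := Nat.exists_eq_succ_of_ne_zero hn
  rw [Finset.prod_range_succ, blaschke_self, norm_zero, mul_zero, mul_zero, norm_le_zero_iff,
    sub_eq_zero] at h
  exact h.symm

lemma schurCofactor_node {n : ℕ} (hn : n ≠ 0) : schurCofactor α f n (α n) = 0 := by
  obtain ⟨k, rfl⟩ := Nat.exists_eq_succ_of_ne_zero hn
  simp only [schurCofactor, cofactor, Nat.succ_eq_add_one, blaschke_self, zero_mul]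

lemma tendsto_schurInterpolant (hα : ∀ k, ‖α k‖ < 1) (hsum : ¬ Summable fun k => 1 - ‖α k‖)
    (hf : IsStrictSchur f) {z : ℂ} (hz : ‖z‖ < 1) :
    Tendsto (fun n => schurInterpolant α f n z) atTop (𝓝 (f z)) := by
  have hsum' : ¬ Summable fun k => 1 - ‖α (k + 1)‖ := fun h =>
    hsum ((summable_nat_add_iff 1).1 h)
  have h := (tendsto_prod_blaschke (fun k => hα (k + 1)) hsum' hz).const_mul 2
  rw [mul_zero] at h
  rw [tendsto_iff_norm_sub_tendsto_zero]
  refine squeeze_zero (fun _ => norm_nonneg _) (fun n => ?_) h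
  rw [norm_sub_rev]
  exact norm_sub_schurInterpolant_le hα hf n hz

lemma tendsto_integral_interpolantDensity (hα : ∀ k, ‖α k‖ < 1)
    (hsum : ¬ Summable fun k => 1 - ‖α k‖) (hf : IsStrictSchur f) {μ : Measure Circle}
    [IsProbabilityMeasure μ] (hμ : IsHerglotzMeasure f μ) {S : Circle → ℝ} (hS : Continuous S) :
    Tendsto (fun n => ∫ t, S t * interpolantDensity α f n t ∂m) atTop (𝓝 (∫ t, S t ∂μ)) := by
  have hi : ∀ n, Integrable (interpolantDensity α f n) m := fun n =>
    integrable_of_continuous (continuous_interpolantDensity hα hf n) m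
  have h0 : ∀ n t, 0 ≤ interpolantDensity α f n t := fun n t =>
    (interpolantDensity_pos hα hf n t).le
  let ν : ℕ → Measure Circle := fun n =>
    m.withDensity fun t => ENNReal.ofReal (interpolantDensity α f n t)
  have hν : ∀ n, IsProbabilityMeasure (ν n) := by
    intro n
    constructor
    rw [withDensity_apply _ MeasurableSet.univ, Measure.restrict_univ,
      ← ofReal_integral_eq_lintegral_ofReal (hi n) (.of_forall (h0 n))]
    -- At `z = 0` the kernel is `1` and the Cayley real part is `1`, so the total mass is one.
    have h := integral_poissonKernel_mul_interpolantDensity hα hf n (z := 0) (by simp)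
    simp only [poissonKernel_circle, norm_zero, sub_zero, Circle.norm_coe, zero_mul] at h
    norm_num [cayleyRe] at h
    rw [h, ENNReal.ofReal_one]
  have h := tendsto_integral_of_tendsto_integral_poissonKernel (ν := ν) (μ := μ)
    (fun z hz => ?_) hS
  · simpa only [ν, integral_withDensity_ofReal (hi _) (h0 _)] using h
  · have hzf : ‖z * f z‖ < 1 := by
      rw [norm_mul]
      exact mul_lt_one_of_nonneg_of_lt_one_left (norm_nonneg _) hz (hf.norm_lt_one z hz).le
    simp only [ν, integral_withDensity_ofReal (hi _) (h0 _),
      integral_poissonKernel_mul_interpolantDensity hα hf _ hz, hμ.integral_poissonKernel hz]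
    exact (continuousAt_cayleyRe hzf).tendsto.comp
      ((tendsto_schurInterpolant hα hsum hf hz).const_mul z)

lemma norm_remainderTrace (hα : ∀ k, ‖α k‖ < 1) (hf : IsStrictSchur f) (n : ℕ) (t : Circle) :
    ‖remainderTrace α f n t‖ = ‖trace (schurRemainder α f n) t‖ := by
  rw [remainderTrace, norm_mul, schurCofactor, norm_cofactor_circle (fun k => hα (k + 1))
    (norm_schurParameter_lt_one hα hf), one_mul]

lemma ae_norm_remainderTrace_lt_one (hα : ∀ k, ‖α k‖ < 1) (hf : IsStrictSchur f) (n : ℕ) :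
    ∀ᵐ t : Circle ∂m, ‖remainderTrace α f n t‖ < 1 := by
  filter_upwards [(isStrictSchur_schurRemainder hα hf n).norm_trace_lt_one] with t ht
  rwa [norm_remainderTrace hα hf]

lemma ae_tendsto_remainderTrace (hα : ∀ k, ‖α k‖ < 1) (hf : IsStrictSchur f) (n : ℕ) :
    ∀ᵐ t : Circle ∂m, Tendsto (fun j => schurCofactor α f n (radius j * t) *
      schurRemainder α f n (radius j * t)) atTop (𝓝 (remainderTrace α f n t)) := by
  filter_upwards [(isStrictSchur_schurRemainder hα hf n).isSchur.ae_tendsto_dilation] with t ht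
  refine Tendsto.mul ?_ ht
  have hc := (diffContOnCl_cofactor (fun k => hα (k + 1)) (norm_schurParameter_lt_one hα hf) n).2
  rw [closure_ball _ one_ne_zero] at hc
  refine (hc t (by simp [Circle.norm_coe])).tendsto.comp
    (tendsto_nhdsWithin_iff.2 ⟨tendsto_radius_mul t, .of_forall fun j => ?_⟩)
  rw [mem_closedBall_zero_iff]
  exact (norm_radius_mul_lt (Circle.norm_coe t).le j).le

lemma aestronglyMeasurable_remainderTrace (hα : ∀ k, ‖α k‖ < 1) (hf : IsStrictSchur f) (n : ℕ) :
    AEStronglyMeasurable (remainderTrace α f n) m := by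
  have hc := (diffContOnCl_cofactor (fun k => hα (k + 1)) (norm_schurParameter_lt_one hα hf) n).2
  rw [closure_ball _ one_ne_zero] at hc
  have : Continuous fun t : Circle => schurCofactor α f n t :=
    hc.comp_continuous (by fun_prop) (by simp [Circle.norm_coe])
  exact this.aestronglyMeasurable.mul
    (isStrictSchur_schurRemainder hα hf n).isSchur.aestronglyMeasurable_trace

lemma differentiableOn_cofactor_mul_remainder (hα : ∀ k, ‖α k‖ < 1) (hf : IsStrictSchur f)
    (n : ℕ) : DifferentiableOn ℂ (fun z => schurCofactor α f n z * schurRemainder α f n z)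
      (Metric.ball 0 1) :=
  (diffContOnCl_cofactor (fun k => hα (k + 1)) (norm_schurParameter_lt_one hα hf) n).1.mul
    (isStrictSchur_schurRemainder hα hf n).differentiableOn

lemma norm_cofactor_mul_remainder_lt_one (hα : ∀ k, ‖α k‖ < 1) (hf : IsStrictSchur f) (n : ℕ)
    (z : ℂ) (hz : ‖z‖ < 1) : ‖schurCofactor α f n z * schurRemainder α f n z‖ < 1 := by
  rw [norm_mul]
  exact (mul_le_of_le_one_left (norm_nonneg _) (norm_cofactor_le_one (fun k => hα (k + 1))
    (norm_schurParameter_lt_one hα hf) n hz.le)).trans_lt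
    ((isStrictSchur_schurRemainder hα hf n).norm_lt_one z hz)

lemma ae_density_eq_interpolantDensity_mul (hα : ∀ k, ‖α k‖ < 1) (hf : IsStrictSchur f)
    {μ : Measure Circle} [IsFiniteMeasure μ] (hμ : IsHerglotzMeasure f μ) (n : ℕ) :
    ∀ᵐ t : Circle ∂m, density μ t =
      interpolantDensity α f n t * cayleyRe (remainderTrace α f n t) := by
  have h1 : ∀ᵐ t : Circle ∂m, ∀ k, ‖trace (schurRemainder α f k) t‖ < 1 :=
    ae_all_iff.2 fun k => (isStrictSchur_schurRemainder hα hf k).norm_trace_lt_one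
  have h2 : ∀ᵐ t : Circle ∂m, ∀ k, trace (schurRemainder α f k) t =
      moebius (blaschke (α (k + 1)) t) (schurParameter α f k)
        (trace (schurRemainder α f (k + 1)) t) :=
    ae_all_iff.2 fun k => ((isStrictSchur_schurRemainder hα hf k).schurStep (hα (k + 1))).2
  filter_upwards [hμ.ae_density_eq hf.isSchur hf.norm_trace_lt_one, h1, h2] with t h3 h4 h5
  rw [h3]
  exact cayleyRe_mul_eq (fun k => hα (k + 1)) (norm_schurParameter_lt_one hα hf) t h4 h5 n

lemma ae_density_pos (hf : IsStrictSchur f) {μ : Measure Circle} [IsFiniteMeasure μ]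
    (hμ : IsHerglotzMeasure f μ) : ∀ᵐ t : Circle ∂m, 0 < density μ t := by
  filter_upwards [hμ.ae_density_eq hf.isSchur hf.norm_trace_lt_one, hf.norm_trace_lt_one]
    with t h1 h2
  rw [h1]
  exact cayleyRe_pos (by rwa [norm_mul, Circle.norm_coe, one_mul])

lemma le_integral_sqrt_remainder (hα : ∀ k, ‖α k‖ < 1) (hf : IsStrictSchur f)
    {μ : Measure Circle} [IsFiniteMeasure μ] (hμ : IsHerglotzMeasure f μ) (n : ℕ)
    {s : Circle → ℝ} (hs : Continuous s) (hs0 : ∀ t, 0 ≤ s t) :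
    3 * ∫ t : Circle, poissonKernel 0 (α n) t * (s t * densityCbrt μ t) ∂m -
      ∫ t : Circle, poissonKernel 0 (α n) t * (s t ^ 3 * interpolantDensity α f n t) ∂m ≤
      2 * ∫ t : Circle, poissonKernel 0 (α n) t * √(cayleyRe (remainderTrace α f n t)) ∂m := by
  have h1 := ae_norm_remainderTrace_lt_one hα hf n
  refine le_integral_sqrt (continuous_interpolantDensity hα hf n)
    (h1.mono fun t ht => cayleyRe_pos ht) (ae_density_eq_interpolantDensity_mul hα hf hμ n)
    (hα n) ?_ hs hs0
  exact integrable_poissonKernel_mul_sqrt (aestronglyMeasurable_remainderTrace hα hf n) h1 (hα n)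
    (integral_poissonKernel_mul_cayleyRe_le (differentiableOn_cofactor_mul_remainder hα hf n)
      (norm_cofactor_mul_remainder_lt_one hα hf n) (ae_tendsto_remainderTrace hα hf n) h1
      (hα n)).1

lemma mem_accCircle (hα : ∀ k, ‖α k‖ < 1) {ψ : ℕ → ℕ} {ξ : Circle}
    (h : Tendsto (fun k => α (ψ k)) atTop (𝓝 (ξ : ℂ))) : ξ ∈ accCircle α := by
  refine ⟨mem_closure_of_tendsto h (.of_forall fun k => mem_range_self _), ?_⟩
  rintro ⟨k, hk⟩
  have := hα k
  rw [hk, Circle.norm_coe] at this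
  exact lt_irrefl _ this

lemma eventually_le_integral_sqrt (hα : ∀ k, ‖α k‖ < 1)
    (hsum : ¬ Summable fun k => 1 - ‖α k‖) (hf : IsStrictSchur f) {μ : Measure Circle}
    [IsProbabilityMeasure μ] (hμ : IsHerglotzMeasure f μ)
    (hreg : DensityContinuousPosNear μ (accCircle α) ∨
      (AccumulatesNontangentially α ∧ DensityLebesguePosOn μ (accCircle α)))
    (hsing : accCircle α ⊆ (μ.singularPart m).supportᶜ) {ψ : ℕ → ℕ} (hψ : StrictMono ψ) {a : ℂ}
    (ha : Tendsto (fun k => α (ψ k)) atTop (𝓝 a)) {ε : ℝ} (hε : 0 < ε) :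
    ∀ᶠ k in atTop, 1 - ε ≤ ∫ t : Circle, poissonKernel 0 (α (ψ k)) t *
      √(cayleyRe (remainderTrace α f (ψ k) t)) ∂m := by
  have ha1 : ‖a‖ ≤ 1 := le_of_tendsto ha.norm (.of_forall fun k => (hα (ψ k)).le)
  rcases ha1.lt_or_eq with ha1 | ha1
  · exact eventually_le_of_tendsto_disk (ae_density_pos hf hμ) ha1 (fun k => hα (ψ k)) ha
      (fun k => continuous_interpolantDensity hα hf (ψ k))
      (fun k t => (interpolantDensity_pos hα hf (ψ k) t).le)
      (fun S hS => (tendsto_integral_interpolantDensity hα hsum hf hμ hS).comp hψ.tendsto_atTop)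
      (fun k s hs hs0 => le_integral_sqrt_remainder hα hf hμ (ψ k) hs hs0) hε
  · obtain ⟨ξ, rfl⟩ : ∃ ξ : Circle, (ξ : ℂ) = a := ⟨⟨a, mem_sphere_zero_iff_norm.2 ha1⟩, rfl⟩
    have hξ := mem_accCircle hα ha
    have hball : Tendsto (fun k => α (ψ k)) atTop (𝓝[Metric.ball 0 1] (ξ : ℂ)) :=
      tendsto_nhdsWithin_iff.2 ⟨ha, .of_forall fun k => by simpa using hα (ψ k)⟩
    obtain ⟨h, hh, hpos, hlim⟩ : ∃ h : Circle → ℝ, h =ᵐ[m] density μ ∧ 0 < h ξ ∧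
        Tendsto (fun k => ∫ t : Circle, poissonKernel 0 (α (ψ k)) t * ‖h t - h ξ‖ ∂m) atTop
          (𝓝 0) := by
      rcases hreg with ⟨U, hU, hEU, h, hh, hc, hpos⟩ | ⟨hnt, h, hh, hleb⟩
      · have hhi : Integrable h m := (integrable_density μ).congr hh.symm
        refine ⟨h, hh, hpos ξ (hEU hξ), ?_⟩
        have hcξ : ContinuousAt h ξ := hc.continuousAt (hU.mem_nhds (hEU hξ))
        refine (tendsto_integral_poissonKernel_mul_of_continuousAt
          (hhi.sub (integrable_const _)).norm (fun t => norm_nonneg _) ?_).comp hball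
        exact tendsto_iff_norm_sub_tendsto_zero.1 hcξ
      · have hhi : Integrable h m := (integrable_density μ).congr hh.symm
        obtain ⟨hl, -, hp⟩ := hleb ξ hξ
        refine ⟨h, hh, hp, ?_⟩
        obtain ⟨C, hC⟩ := hnt ξ ψ hψ ha
        exact (tendsto_integral_poissonKernel_mul_of_average
          (hhi.sub (integrable_const _)).norm (fun t => norm_nonneg _)
          (tendsto_closedBall_average_of_isLebesguePoint hhi hl) C).comp
          (tendsto_nhdsWithin_iff.2 ⟨ha, hC⟩)
    refine eventually_le_of_tendsto_circle hball (hsing hξ) hh hpos hlim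
      (x := fun k => interpolantDensity α f (ψ k)) ?_
      (fun k s hs hs0 => le_integral_sqrt_remainder hα hf hμ (ψ k) hs hs0) hε
    -- Near the circle convergence of the interpolants is not needed: interpolation at the node
    -- itself makes the two Poisson integrals equal there.
    filter_upwards [hψ.tendsto_atTop.eventually_ne_atTop 0] with k hk
    rw [integral_poissonKernel_mul_interpolantDensity hα hf _ (hα _), schurInterpolant_node hα hf hk,
      hμ.integral_poissonKernel (hα _)]

lemma tendsto_integral_norm_remainderTrace (hα : ∀ k, ‖α k‖ < 1)
    (hsum : ¬ Summable fun k => 1 - ‖α k‖) (hf : IsStrictSchur f) {μ : Measure Circle}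
    [IsProbabilityMeasure μ] (hμ : IsHerglotzMeasure f μ)
    (hreg : DensityContinuousPosNear μ (accCircle α) ∨
      (AccumulatesNontangentially α ∧ DensityLebesguePosOn μ (accCircle α)))
    (hsing : accCircle α ⊆ (μ.singularPart m).supportᶜ) :
    Tendsto (fun n => ∫ t : Circle, poissonKernel 0 (α n) t * ‖remainderTrace α f n t‖ ^ 2 ∂m)
      atTop (𝓝 0) := by
  refine tendsto_of_subseq_tendsto fun ns hns => ?_
  obtain ⟨θ, hθ, hnsθ⟩ := strictMono_subseq_of_tendsto_atTop hns
  obtain ⟨a, -, φ, hφ, ha⟩ := (isCompact_closedBall (0 : ℂ) 1).tendsto_subseq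
    (x := fun k => α (ns (θ k))) fun k => by simpa using (hα _).le
  refine ⟨θ ∘ φ, ?_⟩
  have hψ : StrictMono fun k => ns (θ (φ k)) := hnsθ.comp hφ
  rw [Metric.tendsto_nhds]
  intro η hη
  -- With `δ = η/6` and defect at most `δ²`, the estimate gives `3 (δ/2 + δ) = 3η/4 < η`.
  have hδ : 0 < η / 6 := by positivity
  filter_upwards [eventually_le_integral_sqrt hα hsum hf hμ hreg hsing hψ ha
    (show 0 < (η / 6) ^ 2 by positivity), hψ.tendsto_atTop.eventually_ne_atTop 0] with k hk hk0
  have h0 : 0 ≤ ∫ t : Circle, poissonKernel 0 (α (ns ((θ ∘ φ) k))) t *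
      ‖remainderTrace α f (ns ((θ ∘ φ) k)) t‖ ^ 2 ∂m :=
    integral_nonneg fun t => mul_nonneg (poissonKernel_nonneg t (hα _)) (by positivity)
  rw [Real.dist_0_eq_abs, abs_of_nonneg h0]
  set n := ns (θ (φ k))
  have h1 := integral_norm_sq_le (differentiableOn_cofactor_mul_remainder hα hf n)
    (norm_cofactor_mul_remainder_lt_one hα hf n) (aestronglyMeasurable_remainderTrace hα hf n)
    (ae_tendsto_remainderTrace hα hf n) (ae_norm_remainderTrace_lt_one hα hf n) (hα n)
    (by simp only [schurCofactor_node hk0, zero_mul]) hδ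
  refine h1.trans_lt ?_
  have h2 : (1 - ∫ t : Circle, poissonKernel 0 (α n) t *
      √(cayleyRe (remainderTrace α f n t)) ∂m) / (η / 6) ≤ η / 6 := by
    rw [div_le_iff₀ hδ, ← sq]
    linarith
  linarith

end Remainders

end MultipointSchur

end

open MultipointSchur in
theorem mainTheorem4 (α : ℕ → ℂ) (hα0 : α 0 = 0) (hα : ∀ k, ‖α k‖ < 1)
    (hsum : ¬ Summable (fun k => 1 - ‖α k‖))
    (f : ℂ → ℂ) (hf : MultipointSchur.IsSchur f)
    (μ : Measure Circle) [IsProbabilityMeasure μ]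
    (hμ : MultipointSchur.IsHerglotzMeasure f μ)
    (hreg : MultipointSchur.DensityContinuousPosNear μ (MultipointSchur.accCircle α) ∨
      (MultipointSchur.AccumulatesNontangentially α ∧
        MultipointSchur.DensityLebesguePosOn μ (MultipointSchur.accCircle α)))
    (hsing : MultipointSchur.accCircle α ⊆ (μ.singularPart MultipointSchur.m).supportᶜ)
    (hf1 : ∀ᵐ t ∂MultipointSchur.m, ‖MultipointSchur.trace f t‖ < 1) :
    (∀ k, Integrable
      (fun t : Circle =>
        ‖MultipointSchur.trace (MultipointSchur.schurRemainder α f k) t‖ ^ 2 *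
          poissonKernel 0 (α k) t) MultipointSchur.m) ∧
    Tendsto
      (fun k => ∫ t : Circle,
        ‖MultipointSchur.trace (MultipointSchur.schurRemainder α f k) t‖ ^ 2 *
          poissonKernel 0 (α k) t ∂MultipointSchur.m)
      atTop (𝓝 0) := by
  have hs : IsStrictSchur f := hf.isStrictSchur hf1
  -- The cofactor is unimodular on the circle, so multiplying the remainder by it does not change
  -- the integrand.
  have heq : ∀ k (t : Circle), ‖trace (schurRemainder α f k) t‖ ^ 2 * poissonKernel 0 (α k) t =
      poissonKernel 0 (α k) t * ‖remainderTrace α f k t‖ ^ 2 := fun k t => by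
    rw [norm_remainderTrace hα hs, mul_comm]
  simp only [heq]
  refine ⟨fun k => ?_, tendsto_integral_norm_remainderTrace hα hsum hs hμ hreg hsing⟩
  refine integrable_poissonKernel_mul (Integrable.of_bound
    ((aestronglyMeasurable_remainderTrace hα hs k).norm.pow 2) 1 ?_) (hα k)
  filter_upwards [ae_norm_remainderTrace_lt_one hα hs k] with t ht
  have : ‖‖remainderTrace α f k t‖ ^ 2‖ ≤ 1 := by
    rw [norm_pow, norm_norm]
    exact pow_le_one₀ (norm_nonneg _) ht.le
  exact this
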